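/- Supermanifolds are $\mathbb Z$-graded: a supermanifold is a topological space with a sheaf $C^\infty$ of $\mathbb Z$-graded real algebras, locally isomorphic to $\bigl(U,\ C^\infty_U[\xi_i^k : i\neq 0,\ 1\le k\le p_i]\bigr)$ with $U\subseteq\mathbb R^{p_0}$ open, where $|\xi_i^k|=-i$ and the $\xi_i^k$ commute in the graded sense. (Superfunctions are locally polynomial in the $\xi_i^k$, so that these form a sheaf.) Morphisms are continuous maps together with morphisms of sheaves of graded algebras over them that are locally morphisms of such models. A vector field of degree $j$ is a degree $j$ derivation of the sheaf of functions. It is homological if $j=1$ and $[\phi,\phi]=2\phi^2=0$. Vector fields $\phi$ on $\mathcal X$ and $\psi$ on $\mathcal Y$ are $\mu$-related, for $\mu:\mathcal X\to\mathcal Y$, if $\mu^*(\psi f)=\phi(\mu^*f)$ for all functions $f$ on (open parts of) $\mathcal Y$. Let $\mathcal G\rightrightarrows\mathcal M$ be a supergroupoid, that is, a groupoid object in the category of supermanifolds whose source $s$ and target $t$ are surjective submersions, with multiplication $m:\mathcal G^{(2)}=\mathcal G\,{}_s\!\times_t\mathcal G\to\mathcal G$. Put $\mathcal G^{(0)}=\mathcal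 M$, $\mathcal G^{(1)}=\mathcal G$ and, for $q\ge 2$, let $\mathcal G^{(q)}$ be (any choice of) the $q$-fold fibre product of compatible $q$-tuples $(g_1,\dots,g_q)$, i.e. $s(g_i)=t(g_{i+1})$. The face maps $\sigma_i^q:\mathcal G^{(q)}\to\mathcal G^{(q-1)}$, $0\le i\le q$, are $\sigma_0^1=s$, $\sigma_1^1=t$ and, for $q\ge2$, $\sigma^q_0(g_1,\dots,g_q)=(g_2,\dots,g_q)$, $\sigma^q_i(g_1,\dots,g_q)=(g_1,\dots,g_ig_{i+1},\dots,g_q)$ for $0<i<q$, and $\sigma^q_q(g_1,\dots,g_q)=(g_1,\dots,g_{q-1})$. Put $\delta^q=\sum_{i=0}^q(-1)^i(\sigma_i^q)^*:C^\infty(\mathcal G^{(q-1)})\to C^\infty(\mathcal G^{(q)})$. Let $\psi$ be a vector field making $\mathcal G$ a $Q$-groupoid: $\psi$ is a homological vector field on $\mathcal G$ that is multiplicative, i.e. there is a vector field on $\mathcal G^{(2)}$ that is related to $\psi$ under both projections $p_1,p_2:\mathcal G^{(2)}\to\mathcal G$ and under $m$. Then: 1. There is a unique family of degree $1$ vector fields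 $\psi^{(q)}$ on $\mathcal G^{(q)}$, $q\ge0$, with $\psi^{(1)}=\psi$ such that $\psi^{(q)}$ and $\psi^{(q-1)}$ are $\sigma_i^q$-related for all $q\ge1$ and $0\le i\le q$. Each $\psi^{(q)}$ is homological. 2. $\psi$ commutes with the groupoid coboundary: $\psi^{(q)}\circ\delta^q=\delta^q\circ\psi^{(q-1)}$ on $C^\infty(\mathcal G^{(q-1)})$ for all $q\ge1$. 3. Let $C^{p,q}(\mathcal G)=C^\infty_p(\mathcal G^{(q)})$ be the space of functions of degree $p$ on $\mathcal G^{(q)}$, $p\in\mathbb Z$, $q\ge0$. Then $(C^{p,q}(\mathcal G),\delta,\psi)$ is a double complex: $\psi:C^{p,q}\to C^{p+1,q}$ and $\delta:C^{p,q}\to C^{p,q+1}$ satisfy $\psi^2=0$, $\delta^2=0$ and $\psi\delta=\delta\psi$. Its total differential is $D=\psi+(-1)^p\delta$: on $\bigoplus_{p,q}C^{p,q}$, $D$ maps $\bigoplus_{p+q=n}C^{p,q}$ into $\bigoplus_{p+q=n+1}C^{p,q}$, and $D^2=0$. -/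

import Mathlib

open CategoryTheory TopologicalSpace
open scoped ContDiff DirectSum Topology

universe u v w

noncomputable section

namespace ZGraded

/-! ### Graded polynomial variables -/

/-- Labels of the coordinates of nonzero degree of a superdomain of dimension `p`:
there are `p i` of them for every `i ≠ 0`. -/
abbrev Gen (p : ℤ → ℕ) : Type := Σ i : {i : ℤ // i ≠ 0}, Fin (p i)

/-- The coordinates `ξ_i^k` have degree `-i`. -/
def Gen.deg {p : ℤ → ℕ} (x : Gen p) : ℤ := -(x.1 : ℤ)

/-- The graded commutation relations `ξ η = (-1)^{|ξ||η|} η ξ`. -/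
inductive GCRel (p : ℤ → ℕ) : FreeAlgebra ℝ (Gen p) → FreeAlgebra ℝ (Gen p) → Prop
  | comm (x y : Gen p) : GCRel p (FreeAlgebra.ι ℝ x * FreeAlgebra.ι ℝ y)
      ((-1 : ℝ) ^ (x.deg * y.deg) • (FreeAlgebra.ι ℝ y * FreeAlgebra.ι ℝ x))

/-- The free graded-commutative real algebra `ℝ[ξ_i^k]` on the coordinates of nonzero degree. -/
def GCAlg (p : ℤ → ℕ) : Type := RingQuot (GCRel p)

instance (p : ℤ → ℕ) : Ring (GCAlg p) := inferInstanceAs (Ring (RingQuot (GCRel p)))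
instance (p : ℤ → ℕ) : Algebra ℝ (GCAlg p) := inferInstanceAs (Algebra ℝ (RingQuot (GCRel p)))

namespace GCAlg

variable {p : ℤ → ℕ}

/-- The coordinate `ξ` as an element of the algebra. -/
def gen (x : Gen p) : GCAlg p := RingQuot.mkAlgHom ℝ (GCRel p) (FreeAlgebra.ι ℝ x)

theorem gen_mul_gen (x y : Gen p) :
    gen x * gen y = (-1 : ℝ) ^ (x.deg * y.deg) • (gen y * gen x) := by
  have h := RingQuot.mkAlgHom_rel ℝ (GCRel.comm x y)
  rw [map_mul, map_smul, map_mul] at h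
  exact h

/-- Universal property: algebra maps out of `ℝ[ξ]` are given by graded-commuting elements. -/
def lift {B : Type*} [Ring B] [Algebra ℝ B] (f : Gen p → B)
    (hf : ∀ x y, f x * f y = (-1 : ℝ) ^ (x.deg * y.deg) • (f y * f x)) : GCAlg p →ₐ[ℝ] B :=
  RingQuot.liftAlgHom ℝ ⟨FreeAlgebra.lift ℝ f, by
    rintro _ _ ⟨x, y⟩
    simpa only [map_mul, map_smul, FreeAlgebra.lift_ι_apply] using hf x y⟩

@[simp] theorem lift_gen {B : Type*} [Ring B] [Algebra ℝ B] (f : Gen p → B)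
    (hf : ∀ x y, f x * f y = (-1 : ℝ) ^ (x.deg * y.deg) • (f y * f x)) (x : Gen p) :
    lift f hf (gen x) = f x := by
  unfold lift gen
  exact (RingQuot.liftAlgHom_mkAlgHom_apply ℝ _ _ _).trans (FreeAlgebra.lift_ι_apply _ _)

theorem hom_ext {B : Type*} [Ring B] [Algebra ℝ B] {f g : GCAlg p →ₐ[ℝ] B}
    (h : ∀ x, f (gen x) = g (gen x)) : f = g :=
  RingQuot.ringQuot_ext' ℝ f g (FreeAlgebra.hom_ext (funext h))

/-- The degree `k` part: the span of the words of total degree `k` in the coordinates. -/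
def gr (p : ℤ → ℕ) (k : ℤ) : Submodule ℝ (GCAlg p) :=
  Submodule.span ℝ {a | ∃ l : List (Gen p), (l.map Gen.deg).sum = k ∧ (l.map gen).prod = a}

theorem word_mem (l : List (Gen p)) : (l.map gen).prod ∈ gr p (l.map Gen.deg).sum :=
  Submodule.subset_span ⟨l, rfl, rfl⟩

theorem gen_mem (x : Gen p) : gen x ∈ gr p x.deg := by
  simpa using word_mem [x]

instance gradedMonoid : SetLike.GradedMonoid (gr p) where
  one_mem := by simpa using word_mem ([] : List (Gen p))
  mul_mem := by
    intro i j a b ha hb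
    refine Submodule.span_induction₂ (p := fun a b _ _ => a * b ∈ gr p (i + j))
      ?_ ?_ ?_ ?_ ?_ ?_ ?_ ha hb
    · rintro _ _ ⟨l, rfl, rfl⟩ ⟨l', rfl, rfl⟩
      simpa using word_mem (l ++ l')
    · intro y _; simp
    · intro y _; simp
    · intro x y z _ _ _ h1 h2; rw [add_mul]; exact add_mem h1 h2
    · intro x y z _ _ _ h1 h2; rw [mul_add]; exact add_mem h1 h2
    · intro r x y _ _ h; rw [smul_mul_assoc]; exact Submodule.smul_mem _ r h
    · intro r x y _ _ h; rw [mul_smul_comm]; exact Submodule.smul_mem _ r h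

/-- Auxiliary map used to split elements into homogeneous parts. -/
def toSum (p : ℤ → ℕ) : GCAlg p →ₐ[ℝ] ⨁ k, gr p k :=
  lift (fun x => DirectSum.lof ℝ ℤ (fun k => gr p k) x.deg ⟨gen x, gen_mem x⟩) (by
    intro x y
    simp only [DirectSum.lof_eq_of, DirectSum.of_mul_of]
    rw [← DirectSum.lof_eq_of ℝ, ← DirectSum.lof_eq_of ℝ, ← map_smul, DirectSum.lof_eq_of,
      DirectSum.lof_eq_of]
    refine DirectSum.of_eq_of_gradedMonoid_eq (Sigma.subtype_ext (add_comm _ _) ?_)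
    exact gen_mul_gen x y)

instance gradedAlgebra : GradedAlgebra (gr p) :=
  GradedAlgebra.ofAlgHom _ (toSum p)
    (hom_ext fun x => by simp [toSum, DirectSum.lof_eq_of])
    (fun k x => by
      obtain ⟨x, hx⟩ := x
      have key : ∀ (l : List (Gen p)), toSum p (l.map gen).prod =
          DirectSum.of (fun k => gr p k) (l.map Gen.deg).sum ⟨_, word_mem l⟩ := by
        intro l
        induction l with
        | nil => simp only [List.map_nil, List.prod_nil, map_one]; rfl
        | cons a l ih =>
          simp only [List.map_cons, List.prod_cons, map_mul, ih]
          simp only [toSum, lift_gen, DirectSum.lof_eq_of, DirectSum.of_mul_of]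
          exact DirectSum.of_eq_of_gradedMonoid_eq (Sigma.subtype_ext
            (show a.deg + (l.map Gen.deg).sum = ((a :: l).map Gen.deg).sum by simp) rfl)
      dsimp only
      induction hx using Submodule.span_induction with
      | mem y hy =>
        obtain ⟨l, rfl, rfl⟩ := hy
        exact key l
      | zero => rw [map_zero]; exact (map_zero (DirectSum.of (fun k => gr p k) k)).symm
      | add y z hy hz h1 h2 => rw [map_add, h1, h2, ← map_add]; rfl
      | smul r y hy h1 =>
        rw [map_smul, h1, ← DirectSum.lof_eq_of ℝ, ← map_smul]; rfl)

/-- The evaluation map `ℝ[ξ] → ℝ`, killing all coordinates of nonzero degree. -/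
def ev (p : ℤ → ℕ) : GCAlg p →ₐ[ℝ] ℝ := lift (fun _ => 0) (by simp)

end GCAlg

/-! ### Spaces with a sheaf of graded algebras -/

/-- A topological space with a sheaf of `ℤ`-graded (associative, unital) real algebras.
`sec U = ⨁ k, gr U k` is the algebra of sections over `U`; the sheaf condition is imposed degree by
degree, as is appropriate for a sheaf with values in graded algebras. -/
structure GrSpace where
  carrier : Type u
  [top : TopologicalSpace carrier]
  sec : Opens carrier → Type u
  [ring : ∀ U, Ring (sec U)]
  [algebra : ∀ U, Algebra ℝ (sec U)]
  gr : ∀ U, ℤ → Submodule ℝ (sec U)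
  [gradedMonoid : ∀ U, SetLike.GradedMonoid (gr U)]
  isInternal : ∀ U, DirectSum.IsInternal (gr U)
  res : ∀ {U V : Opens carrier}, V ≤ U → sec U →ₐ[ℝ] sec V
  res_mem : ∀ {U V : Opens carrier} (h : V ≤ U) {k : ℤ} {f : sec U}, f ∈ gr U k → res h f ∈ gr V k
  res_refl : ∀ {U : Opens carrier} (f : sec U), res le_rfl f = f
  res_res : ∀ {U V W : Opens carrier} (h : V ≤ U) (h' : W ≤ V) (f : sec U),
    res h' (res h f) = res (h'.trans h) f
  glue : ∀ {U : Opens carrier} {ι : Type u} (V : ι → Opens carrier) (hV : ∀ i, V i ≤ U),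
    (∀ x ∈ U, ∃ i, x ∈ V i) → ∀ (k : ℤ) (f : ∀ i, sec (V i)), (∀ i, f i ∈ gr (V i) k) →
    (∀ i j, res (inf_le_left : V i ⊓ V j ≤ V i) (f i) = res (inf_le_right : V i ⊓ V j ≤ V j) (f j)) →
    ∃! g : sec U, g ∈ gr U k ∧ ∀ i, res (hV i) g = f i

attribute [instance] GrSpace.top GrSpace.ring GrSpace.algebra GrSpace.gradedMonoid

/-- A morphism: a continuous map `base` with a morphism of sheaves of graded algebras over it. -/
@[ext]
structure GrHom (X : GrSpace.{u}) (Y : GrSpace.{v}) where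
  base : C(X.carrier, Y.carrier)
  pull : ∀ V : Opens Y.carrier, Y.sec V →ₐ[ℝ] X.sec (Opens.comap base V)
  pull_mem : ∀ (V : Opens Y.carrier) {k : ℤ} {f : Y.sec V}, f ∈ Y.gr V k →
    pull V f ∈ X.gr (Opens.comap base V) k
  pull_res : ∀ {V W : Opens Y.carrier} (h : W ≤ V) (f : Y.sec V),
    pull W (Y.res h f) = X.res (Opens.comap_mono base h) (pull V f)

namespace GrHom

/-- The identity morphism. -/
def id (X : GrSpace.{u}) : GrHom X X where
  base := ContinuousMap.id _
  pull V := AlgHom.id ℝ (X.sec V)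
  pull_mem _ _ _ h := h
  pull_res _ _ := rfl

/-- Composition (`f` first, then `g`). -/
def comp {X : GrSpace.{u}} {Y : GrSpace.{v}} {Z : GrSpace.{w}} (f : GrHom X Y) (g : GrHom Y Z) :
    GrHom X Z where
  base := g.base.comp f.base
  pull V := (f.pull (Opens.comap g.base V)).comp (g.pull V)
  pull_mem V _ _ h := f.pull_mem _ (g.pull_mem V h)
  pull_res h s := by
    change f.pull _ (g.pull _ _) = _
    rw [g.pull_res, f.pull_res]; rfl

/-- `f` is an isomorphism onto an open subspace of the target. -/
def IsOpenImmersion {X : GrSpace.{u}} {Y : GrSpace.{v}} (f : GrHom X Y) : Prop :=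
  Topology.IsOpenEmbedding f.base ∧
    ∀ V : Opens Y.carrier, (V : Set Y.carrier) ⊆ Set.range f.base → Function.Bijective (f.pull V)

end GrHom

/-! ### Superdomains -/

/-- The space `ℝ^{p_0}`. -/
abbrev Body (p : ℤ → ℕ) : Type := EuclideanSpace ℝ (Fin (p 0))

theorem isInternal_of_components {M : Type*} [AddCommGroup M] [Module ℝ M]
    (gr : ℤ → Submodule ℝ M) (c : ∀ k, M →ₗ[ℝ] gr k)
    (h1 : ∀ k x, x ∈ gr k → (c k x : M) = x) (h2 : ∀ j k x, x ∈ gr k → j ≠ k → c j x = 0)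
    (h3 : ∀ x, ∃ F : Finset ℤ, ∀ k ∉ F, c k x = 0) (h4 : ∀ x, (∀ k, c k x = 0) → x = 0) :
    DirectSum.IsInternal gr := by
  have hval : ∀ (j : ℤ) (x : ⨁ k, gr k), c j (DirectSum.coeLinearMap gr x) = x j := by
    intro j x
    induction x using DirectSum.induction_on with
    | zero => simp
    | of i f =>
      rw [DirectSum.coeLinearMap_of]
      by_cases h : i = j
      · subst h
        rw [DirectSum.of_eq_same]
        exact Subtype.ext (h1 _ _ f.2)
      · rw [h2 j i _ f.2 (Ne.symm h), DirectSum.of_eq_of_ne _ _ _ (Ne.symm h)]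
    | add a b ha hb => rw [map_add, map_add, ha, hb, DirectSum.add_apply]
  constructor
  · intro x y hxy
    refine DFinsupp.ext fun j => ?_
    rw [← hval j x, ← hval j y]
    exact congrArg (c j) hxy
  · intro x
    obtain ⟨F, hF⟩ := h3 x
    refine ⟨∑ k ∈ F, DirectSum.of (fun k => gr k) k (c k x), ?_⟩
    change DirectSum.coeLinearMap gr _ = x
    rw [← sub_eq_zero]
    refine h4 _ fun j => ?_
    rw [map_sub, hval, DFinsupp.finsetSum_apply, sub_eq_zero]
    by_cases hj : j ∈ F
    · rw [Finset.sum_eq_single_of_mem j hj]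
      · exact DirectSum.of_eq_same _ _
      · intro i _ hij
        exact DirectSum.of_eq_of_ne _ _ _ (Ne.symm hij)
    · rw [Finset.sum_eq_zero, hF j hj]
      intro i hi
      refine DirectSum.of_eq_of_ne _ _ _ ?_
      rintro rfl
      exact hj hi

section Superdomain

variable {p : ℤ → ℕ} {U : Opens (Body p)}

/-- An element of `C^∞(W)[ξ_i^k]`, regarded as a function from `W` to `ℝ[ξ_i^k]`: locally it is a
finite sum `∑ g_a s_a` with smooth coefficients `g_a` and `s_a ∈ ℝ[ξ_i^k]`. (Being a polynomial in
the `ξ_i^k` is a local condition, so that a sheaf results. If the nonzero degrees of the coordinates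
all have the same sign, then homogeneous elements are globally polynomial.) -/
def IsSuperfunction {W : Opens U} (f : W → GCAlg p) : Prop :=
  ∀ x : W, ∃ N : Set (Body p), IsOpen N ∧ ((x : U) : Body p) ∈ N ∧
    ∃ (ι : Type) (_ : Fintype ι) (g : ι → Body p → ℝ) (s : ι → GCAlg p),
      (∀ a, ContDiffOn ℝ ∞ (g a) N) ∧
      ∀ y : W, ((y : U) : Body p) ∈ N → f y = ∑ a, g a ((y : U) : Body p) • s a

theorem IsSuperfunction.const {W : Opens U} (s : GCAlg p) :
    IsSuperfunction (fun _ : W => s) := fun x =>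
  ⟨Set.univ, isOpen_univ, trivial, Unit, inferInstance, fun _ _ => 1, fun _ => s,
    fun _ => contDiffOn_const, fun y _ => by simp⟩

theorem IsSuperfunction.add {W : Opens U} {f g : W → GCAlg p} (hf : IsSuperfunction f)
    (hg : IsSuperfunction g) : IsSuperfunction (f + g) := by
  intro x
  obtain ⟨N, hN, hx, ι, _, a, s, ha, e⟩ := hf x
  obtain ⟨N', hN', hx', ι', _, a', s', ha', e'⟩ := hg x
  refine ⟨N ∩ N', hN.inter hN', ⟨hx, hx'⟩, ι ⊕ ι', inferInstance, Sum.elim a a', Sum.elim s s',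
    ?_, ?_⟩
  · rintro (i | i)
    · exact (ha i).mono Set.inter_subset_left
    · exact (ha' i).mono Set.inter_subset_right
  · intro y hy
    simp [e y hy.1, e' y hy.2]

theorem IsSuperfunction.mul {W : Opens U} {f g : W → GCAlg p} (hf : IsSuperfunction f)
    (hg : IsSuperfunction g) : IsSuperfunction (f * g) := by
  intro x
  obtain ⟨N, hN, hx, ι, _, a, s, ha, e⟩ := hf x
  obtain ⟨N', hN', hx', ι', _, a', s', ha', e'⟩ := hg x
  refine ⟨N ∩ N', hN.inter hN', ⟨hx, hx'⟩, ι × ι', inferInstance, fun i y => a i.1 y * a' i.2 y,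
    fun i => s i.1 * s' i.2, ?_, ?_⟩
  · rintro ⟨i, j⟩
    exact ((ha i).mono Set.inter_subset_left).mul ((ha' j).mono Set.inter_subset_right)
  · intro y hy
    simp only [Pi.mul_apply, e y hy.1, e' y hy.2, Fintype.sum_prod_type, Finset.sum_mul_sum,
      smul_mul_smul_comm]

theorem IsSuperfunction.map {W : Opens U} {f : W → GCAlg p} (hf : IsSuperfunction f)
    (T : GCAlg p →ₗ[ℝ] GCAlg p) : IsSuperfunction (fun y => T (f y)) := by
  intro x
  obtain ⟨N, hN, hx, ι, _, a, s, ha, e⟩ := hf x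
  refine ⟨N, hN, hx, ι, inferInstance, a, fun i => T (s i), ha, fun y hy => ?_⟩
  simp [e y hy]

/-- The algebra of sections over `W`: superfunctions with finitely many homogeneous components. -/
def SDSec (W : Opens U) : Subalgebra ℝ (W → GCAlg p) where
  carrier := {f | IsSuperfunction f ∧
    ∃ F : Finset ℤ, ∀ y, ∀ k ∉ F, GradedAlgebra.proj (GCAlg.gr p) k (f y) = 0}
  algebraMap_mem' r := by
    refine ⟨IsSuperfunction.const _, {0}, fun y k hk => ?_⟩
    have h : algebraMap ℝ (W → GCAlg p) r y ∈ GCAlg.gr p 0 :=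
      SetLike.algebraMap_mem_graded (GCAlg.gr p) r
    rw [GradedAlgebra.proj_apply, DirectSum.decompose_of_mem_ne _ h]
    simpa [eq_comm] using hk
  add_mem' := by
    rintro f g ⟨hf, F, hF⟩ ⟨hg, G, hG⟩
    refine ⟨hf.add hg, F ∪ G, fun y k hk => ?_⟩
    simp only [Finset.mem_union, not_or] at hk
    rw [Pi.add_apply, map_add, hF y k hk.1, hG y k hk.2, add_zero]
  mul_mem' := by
    rintro f g ⟨hf, F, hF⟩ ⟨hg, G, hG⟩
    refine ⟨hf.mul hg, Finset.image₂ (· + ·) F G, fun y k hk => ?_⟩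
    have key : ∀ (H : Finset ℤ) (a : GCAlg p),
        (∀ k ∉ H, GradedAlgebra.proj (GCAlg.gr p) k a = 0) →
        a = ∑ k ∈ H, GradedAlgebra.proj (GCAlg.gr p) k a := by
      intro H a ha
      classical
      conv_lhs => rw [← DirectSum.sum_support_decompose (GCAlg.gr p) a]
      refine Finset.sum_subset_zero_on_sdiff ?_ ?_ (fun _ _ => rfl)
      · intro k hk
        by_contra hkH
        rw [DFinsupp.mem_support_iff] at hk
        exact hk (Subtype.ext (ha k hkH))
      · intro k hk
        simp only [Finset.mem_sdiff, DFinsupp.mem_support_iff, not_not] at hk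
        rw [GradedAlgebra.proj_apply, hk.2]; rfl
    rw [Pi.mul_apply, key F (f y) (hF y), key G (g y) (hG y), Finset.sum_mul_sum, map_sum]
    refine Finset.sum_eq_zero fun i hi => ?_
    rw [map_sum]
    refine Finset.sum_eq_zero fun j hj => ?_
    have h := SetLike.mul_mem_graded (A := GCAlg.gr p)
      (SetLike.coe_mem (DirectSum.decompose (GCAlg.gr p) (f y) i))
      (SetLike.coe_mem (DirectSum.decompose (GCAlg.gr p) (g y) j))
    rw [GradedAlgebra.proj_apply, GradedAlgebra.proj_apply, GradedAlgebra.proj_apply,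
      DirectSum.decompose_of_mem_ne _ h]
    rintro rfl
    exact hk (Finset.mem_image₂_of_mem hi hj)

/-- The sections of degree `k`. -/
def SDSec.gr (W : Opens U) (k : ℤ) : Submodule ℝ (SDSec W) where
  carrier := {f | ∀ y, f.1 y ∈ GCAlg.gr p k}
  add_mem' hf hg y := add_mem (hf y) (hg y)
  zero_mem' _ := zero_mem _
  smul_mem' r _ hf y := Submodule.smul_mem _ r (hf y)

instance SDSec.gradedMonoid (W : Opens U) : SetLike.GradedMonoid (SDSec.gr W) where
  one_mem _ := SetLike.GradedOne.one_mem
  mul_mem _ _ _ _ hf hg y := SetLike.GradedMul.mul_mem (hf y) (hg y)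

/-- Homogeneous components of a section. -/
def SDSec.comp {W : Opens U} (k : ℤ) : SDSec W →ₗ[ℝ] SDSec.gr W k where
  toFun f := ⟨⟨fun y => GradedAlgebra.proj (GCAlg.gr p) k (f.1 y), f.2.1.map _, {k}, fun y j hj => by
    have h : GradedAlgebra.proj (GCAlg.gr p) k (f.1 y) ∈ GCAlg.gr p k := SetLike.coe_mem _
    exact DirectSum.decompose_of_mem_ne _ h (by simpa [eq_comm] using hj)⟩, fun _ => SetLike.coe_mem _⟩
  map_add' f g := Subtype.ext (Subtype.ext (funext fun y =>
    map_add (GradedAlgebra.proj (GCAlg.gr p) k) (f.1 y) (g.1 y)))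
  map_smul' r f := Subtype.ext (Subtype.ext (funext fun y =>
    map_smul (GradedAlgebra.proj (GCAlg.gr p) k) r (f.1 y)))

theorem SDSec.isInternal (W : Opens U) : DirectSum.IsInternal (SDSec.gr W) := by
  refine isInternal_of_components (SDSec.gr W) SDSec.comp ?_ ?_ ?_ ?_
  · intro k f hf
    exact Subtype.ext (funext fun y => DirectSum.decompose_of_mem_same _ (hf y))
  · intro j k f hf hjk
    exact Subtype.ext (Subtype.ext (funext fun y =>
      DirectSum.decompose_of_mem_ne _ (hf y) (Ne.symm hjk)))
  · intro f
    obtain ⟨F, hF⟩ := f.2.2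
    exact ⟨F, fun k hk => Subtype.ext (Subtype.ext (funext fun y => hF y k hk))⟩
  · intro f h
    refine Subtype.ext (funext fun y => (DirectSum.decompose (GCAlg.gr p)).injective ?_)
    refine DFinsupp.ext fun j => Subtype.ext ?_
    refine (congrFun (congrArg (fun t => t.1.1) (h j)) y).trans ?_
    exact (map_zero (GradedAlgebra.proj (GCAlg.gr p) j)).symm

/-- Restriction of sections. -/
def SDSec.res {V W : Opens U} (h : W ≤ V) : SDSec V →ₐ[ℝ] SDSec W where
  toFun f := ⟨fun y => f.1 ⟨y, h y.2⟩, by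
    obtain ⟨hf, F, hF⟩ := f.2
    refine ⟨fun x => ?_, F, fun y => hF ⟨y, h y.2⟩⟩
    obtain ⟨N, hN, hx, ι, i, g, s, hg, e⟩ := hf ⟨x, h x.2⟩
    exact ⟨N, hN, hx, ι, i, g, s, hg, fun y hy => e ⟨y, h y.2⟩ hy⟩⟩
  map_one' := rfl
  map_mul' _ _ := rfl
  map_zero' := rfl
  map_add' _ _ := rfl
  commutes' _ := rfl

end Superdomain

/-- The superdomain of dimension `p` with support `U`. -/
abbrev superdomain (p : ℤ → ℕ) (U : Opens (Body p)) : GrSpace.{0} where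
  carrier := U
  sec W := SDSec W
  gr W := SDSec.gr W
  isInternal := SDSec.isInternal
  res h := SDSec.res h
  res_mem _ _ _ hf y := hf ⟨y, _⟩
  res_refl _ := rfl
  res_res _ _ _ := rfl
  glue := by
    intro V ι W hW hcov k f hf hcomp
    choose i hi using hcov
    have hcompat : ∀ (a b : ι) (y : U) (ha : y ∈ W a) (hb : y ∈ W b),
        (f a).1 ⟨y, ha⟩ = (f b).1 ⟨y, hb⟩ := fun a b y ha hb =>
      congrFun (congrArg Subtype.val (hcomp a b)) ⟨y, ha, hb⟩
    have hmem : ∀ y : V, (f (i y y.2)).1 ⟨y, hi y y.2⟩ ∈ GCAlg.gr p k := fun y => hf _ _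
    refine ⟨⟨fun y => (f (i y y.2)).1 ⟨y, hi y y.2⟩, ?_, {k}, ?_⟩, ⟨hmem, ?_⟩, ?_⟩
    · intro x
      obtain ⟨N, hN, hx, κ, _, g, s, hg, e⟩ := (f (i x x.2)).2.1 ⟨x, hi x x.2⟩
      obtain ⟨O, hO, hOW⟩ := isOpen_induced_iff.1 (W (i x x.2)).2
      refine ⟨N ∩ O, hN.inter hO, ⟨hx, ?_⟩, κ, inferInstance, g, s,
        fun a => (hg a).mono Set.inter_subset_left, fun y hy => ?_⟩
      · have : (x : U) ∈ Subtype.val ⁻¹' O := by rw [hOW]; exact hi x x.2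
        exact this
      · have hyW : (y : U) ∈ W (i x x.2) := by
          have : (y : U) ∈ Subtype.val ⁻¹' O := hy.2
          rw [hOW] at this; exact this
        rw [← e ⟨y, hyW⟩ hy.1]
        exact hcompat _ _ _ _ _
    · intro y j hj
      rw [GradedAlgebra.proj_apply, DirectSum.decompose_of_mem_ne _ (hmem y)]
      simpa [eq_comm] using hj
    · intro a
      exact Subtype.ext (funext fun y => hcompat _ _ _ _ _)
    · rintro g ⟨_, hg⟩
      refine Subtype.ext (funext fun y => ?_)
      exact congrFun (congrArg Subtype.val (hg (i y y.2))) ⟨y, hi y y.2⟩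

namespace superdomain

variable {p q : ℤ → ℕ} {U : Opens (Body p)} {V : Opens (Body q)}

/-- The evaluation map from superfunctions on `W` to ordinary functions on `W`. -/
def ev (W : Opens U) : (superdomain p U).sec W →ₐ[ℝ] (W → ℝ) :=
  ((GCAlg.ev p).compLeft W).comp (SDSec W).val

/-- Constant superfunctions. -/
def const (W : Opens U) : GCAlg p →ₐ[ℝ] (superdomain p U).sec W where
  toFun s := ⟨fun _ => s, IsSuperfunction.const s, by
    classical
    refine ⟨DFinsupp.support (DirectSum.decompose (GCAlg.gr p) s), fun _ k hk => ?_⟩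
    rw [DFinsupp.mem_support_iff, not_not] at hk
    rw [GradedAlgebra.proj_apply, hk]; rfl⟩
  map_one' := rfl
  map_mul' _ _ := rfl
  map_zero' := rfl
  map_add' _ _ := rfl
  commutes' _ := rfl

/-- Ordinary smooth functions as superfunctions. -/
def ofSmooth (W : Opens U) (N : Set (Body p)) (hN : IsOpen N)
    (hW : ∀ y : W, ((y : U) : Body p) ∈ N) (g : Body p → ℝ) (hg : ContDiffOn ℝ ∞ g N) :
    (superdomain p U).sec W :=
  ⟨fun y => g ((y : U) : Body p) • 1, fun x => ⟨N, hN, hW x, Unit, inferInstance, fun _ => g,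
    fun _ => 1, fun _ => hg, fun y _ => by simp⟩, {0}, fun y k hk => by
      rw [GradedAlgebra.proj_apply, DirectSum.decompose_of_mem_ne (GCAlg.gr p)
        (Submodule.smul_mem _ _ SetLike.GradedOne.one_mem)]
      simpa [eq_comm] using hk⟩

variable (U) in
/-- The coordinate functions of degree `0`. -/
def baseCoord (k : Fin (p 0)) : (superdomain p U).sec ⊤ :=
  ofSmooth ⊤ Set.univ isOpen_univ (fun _ => trivial) (fun y => y k)
    (by fun_prop)

variable (U) in
/-- The coordinate functions of nonzero degree. -/
def genCoord (x : Gen p) : (superdomain p U).sec ⊤ := const ⊤ (GCAlg.gen x)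

theorem ev_gr (W : Opens U) {k : ℤ} (hk : k ≠ 0) {f : (superdomain p U).sec W}
    (hf : f ∈ (superdomain p U).gr W k) : ev W f = 0 := by
  have key : ∀ a ∈ GCAlg.gr p k, GCAlg.ev p a = 0 := by
    intro a ha
    induction ha using Submodule.span_induction with
    | mem y hy =>
      obtain ⟨l, hl, rfl⟩ := hy
      cases l with
      | nil => exact absurd hl.symm hk
      | cons x l => simp [GCAlg.ev]
    | zero => exact map_zero _
    | add y z _ _ h1 h2 => rw [map_add, h1, h2, add_zero]
    | smul r y _ h => rw [map_smul, h, smul_zero]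
  exact funext fun y => key _ (hf y)

/-- A morphism of sheaves of graded algebras between superdomains commutes with evaluation. -/
theorem ev_pull (μ : GrHom (superdomain p U) (superdomain q V)) (W : Opens V)
    (f : (superdomain q V).sec W) (x : U) (hx : μ.base x ∈ W) :
    ev _ (μ.pull W f) ⟨x, hx⟩ = ev W f ⟨μ.base x, hx⟩ := by
  obtain ⟨N, hN, hxN, ι, _, g, s, hg, e⟩ := f.2.1 ⟨μ.base x, hx⟩
  let W' : Opens V := W ⊓ ⟨Subtype.val ⁻¹' N, hN.preimage continuous_subtype_val⟩
  have hW' : W' ≤ W := inf_le_left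
  have hx' : μ.base x ∈ W' := ⟨hx, hxN⟩
  have hWN : ∀ y : W', ((y : V) : Body q) ∈ N := fun y => y.2.2
  -- the character of the sections near `μ x` obtained by pulling back and evaluating at `x`
  let χ : (superdomain q V).sec W' →ₐ[ℝ] ℝ :=
    (Pi.evalAlgHom ℝ _ ⟨x, hx'⟩).comp ((ev _).comp (μ.pull W'))
  let χ' : (superdomain q V).sec W' →ₐ[ℝ] ℝ := (Pi.evalAlgHom ℝ _ ⟨μ.base x, hx'⟩).comp (ev W')
  have hconst : χ.comp (const W') = GCAlg.ev q := by
    refine GCAlg.hom_ext fun a => ?_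
    have h1 : const W' (GCAlg.gen a) ∈ (superdomain q V).gr W' a.deg := fun _ => GCAlg.gen_mem a
    have h2 := ev_gr (p := p) (U := U) _ (neg_ne_zero.2 a.1.2) (μ.pull_mem W' h1)
    exact (congrFun h2 ⟨x, hx'⟩).trans (by simp [GCAlg.ev])
  have hsm : ∀ a, χ (ofSmooth W' N hN hWN (g a) (hg a)) = g a (μ.base x : V) := by
    intro a
    by_contra hne
    set c := χ (ofSmooth W' N hN hWN (g a) (hg a)) with hc
    have hcont : ContinuousOn (g a) N := (hg a).continuousOn
    let N' : Set (Body q) := N ∩ g a ⁻¹' {c}ᶜ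
    have hN' : IsOpen N' := hcont.isOpen_inter_preimage hN isOpen_compl_singleton
    let W'' : Opens V := W' ⊓ ⟨Subtype.val ⁻¹' N', hN'.preimage continuous_subtype_val⟩
    have hW'' : W'' ≤ W' := inf_le_left
    have hx'' : μ.base x ∈ W'' := ⟨hx', hxN, fun h => hne h.symm⟩
    have hWN' : ∀ y : W'', ((y : V) : Body q) ∈ N' := fun y => y.2.2
    have hinv : ContDiffOn ℝ ∞ (fun y => (g a y - c)⁻¹) N' :=
      (((hg a).mono Set.inter_subset_left).sub contDiffOn_const).inv
        fun y hy => sub_ne_zero.2 hy.2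
    let u := (superdomain q V).res hW'' (ofSmooth W' N hN hWN (g a) (hg a)) -
      algebraMap ℝ ((superdomain q V).sec W'') c
    let v : (superdomain q V).sec W'' := ofSmooth W'' N' hN' hWN' _ hinv
    have huv : u * v = 1 := by
      refine Subtype.ext (funext fun y => ?_)
      have h0 : g a ((y : V) : Body q) - c ≠ 0 := sub_ne_zero.2 (hWN' y).2
      change (g a ((y : V) : Body q) • (1 : GCAlg q) - algebraMap ℝ (GCAlg q) c) *
        ((g a ((y : V) : Body q) - c)⁻¹ • (1 : GCAlg q)) = 1
      rw [Algebra.algebraMap_eq_smul_one, ← sub_smul, smul_mul_smul_comm, mul_inv_cancel₀ h0,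
        mul_one, one_smul]
    let χ'' : (superdomain q V).sec W'' →ₐ[ℝ] ℝ :=
      (Pi.evalAlgHom ℝ _ ⟨x, hx''⟩).comp ((ev _).comp (μ.pull W''))
    have hu : χ'' u = 0 := by
      have : χ'' ((superdomain q V).res hW'' (ofSmooth W' N hN hWN (g a) (hg a))) = c := by
        change ev _ (μ.pull W'' _) _ = _
        rw [μ.pull_res]; rfl
      rw [map_sub, this, AlgHom.commutes]
      exact sub_self c
    have := congrArg χ'' huv
    rw [map_mul, hu, zero_mul, map_one] at this
    exact zero_ne_one this
  have hres : (superdomain q V).res hW' f =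
      ∑ a, ofSmooth W' N hN hWN (g a) (hg a) * const W' (s a) := by
    refine Subtype.ext (funext fun y => ?_)
    refine (e ⟨y, hW' y.2⟩ (hWN y)).trans ?_
    have : ((∑ a, ofSmooth W' N hN hWN (g a) (hg a) * const W' (s a) : SDSec W') :
        W' → GCAlg q) y = ∑ a, (g a ((y : V) : Body q) • (1 : GCAlg q)) * s a := by
      rw [AddSubmonoidClass.coe_finsetSum, Finset.sum_apply]; rfl
    refine Eq.trans ?_ this.symm
    simp
  have h1 : ev _ (μ.pull W f) ⟨x, hx⟩ = χ ((superdomain q V).res hW' f) := by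
    change _ = ev _ (μ.pull W' _) _
    rw [μ.pull_res]; rfl
  have h2 : ev W f ⟨μ.base x, hx⟩ = χ' ((superdomain q V).res hW' f) := rfl
  have h3 : ∀ a, χ (const W' (s a)) = GCAlg.ev q (s a) := fun a => AlgHom.congr_fun hconst (s a)
  rw [h1, h2, hres, map_sum, map_sum]
  refine Finset.sum_congr rfl fun a _ => ?_
  rw [map_mul, map_mul, h3, hsm]
  refine congrArg (· * _) ?_
  change _ = GCAlg.ev q (g a (μ.base x : V) • (1 : GCAlg q))
  rw [map_smul, map_one, smul_eq_mul, mul_one]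

/-- A morphism of sheaves of graded algebras between superdomains has a smooth underlying map. -/
theorem contDiffOn_base (μ : GrHom (superdomain p U) (superdomain q V)) :
    ContDiffOn ℝ ∞ (Function.extend (Subtype.val : U → Body p)
      (fun y => (μ.base y : Body q)) 0) U := by
  have hinj : Function.Injective (Subtype.val : U → Body p) := Subtype.val_injective
  rw [contDiffOn_euclidean]
  intro k x hx
  obtain ⟨N, hN, hxN, ι, _, g, s, hg, e⟩ := (μ.pull ⊤ (baseCoord V k)).2.1 ⟨⟨x, hx⟩, trivial⟩
  have h : ∀ y ∈ (U : Set (Body p)) ∩ N, (Function.extend (Subtype.val : U → Body p)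
      (fun y => (μ.base y : Body q)) 0 y) k = ∑ a, g a y * GCAlg.ev p (s a) := by
    intro y hy
    have h1 := hinj.extend_apply (fun y => (μ.base y : Body q)) 0 ⟨y, hy.1⟩
    have h2 := ev_pull μ ⊤ (baseCoord V k) ⟨y, hy.1⟩ trivial
    have h3 : ev _ (μ.pull ⊤ (baseCoord V k)) ⟨⟨y, hy.1⟩, trivial⟩ =
        ∑ a, g a y * GCAlg.ev p (s a) := by
      change GCAlg.ev p ((μ.pull ⊤ (baseCoord V k)).1 ⟨⟨y, hy.1⟩, trivial⟩) = _
      rw [e _ hy.2, map_sum]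
      exact Finset.sum_congr rfl fun a _ => by rw [map_smul, smul_eq_mul]
    have h4 : ev ⊤ (baseCoord V k) ⟨μ.base ⟨y, hy.1⟩, trivial⟩ =
        (μ.base ⟨y, hy.1⟩ : Body q) k := by
      change GCAlg.ev q ((μ.base ⟨y, hy.1⟩ : Body q) k • (1 : GCAlg q)) = _
      rw [map_smul, map_one, smul_eq_mul, mul_one]
    rw [h1, ← h4, ← h2, h3]
  have hsm : ContDiffOn ℝ ∞ (fun y => ∑ a, g a y * GCAlg.ev p (s a)) ((U : Set (Body p)) ∩ N) :=
    ContDiffOn.sum fun a _ => ((hg a).mono Set.inter_subset_right).mul contDiffOn_const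
  have := (hsm.congr h) x ⟨hx, hxN⟩
  exact (this.contDiffAt ((U.2.inter hN).mem_nhds ⟨hx, hxN⟩)).contDiffWithinAt

end superdomain

/-! ### Supermanifolds -/

/-- A (`ℤ`-graded) supermanifold of dimension `dim`: a space with a sheaf of graded algebras that is
locally isomorphic to a superdomain of dimension `dim`. -/
structure Supermanifold where
  toGrSpace : GrSpace.{u}
  dim : ℤ → ℕ
  locally_superdomain : ∀ x : toGrSpace.carrier, ∃ (U : Opens (Body dim))
    (φ : GrHom (superdomain dim U) toGrSpace), φ.IsOpenImmersion ∧ x ∈ Set.range φ.base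

namespace Supermanifold

/-- The category of supermanifolds. A morphism is a continuous map with a morphism of sheaves of
graded algebras over it; it is automatically given by morphisms of superdomains locally, i.e. in
charts its underlying map is smooth and it commutes with evaluation, by
`superdomain.contDiffOn_base` and `superdomain.ev_pull`. -/
instance : Category Supermanifold.{u} where
  Hom X Y := GrHom X.toGrSpace Y.toGrSpace
  id X := GrHom.id X.toGrSpace
  comp f g := GrHom.comp f g

/-- The algebra `C^∞(X)` of global functions. -/
abbrev Fun (X : Supermanifold.{u}) : Type u := X.toGrSpace.sec ⊤

/-- The space `C^∞_k(X)` of global functions of degree `k`. -/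
abbrev FunDeg (X : Supermanifold.{u}) (k : ℤ) : Submodule ℝ X.Fun := X.toGrSpace.gr ⊤ k

/-- The support of a supermanifold. -/
abbrev supp (X : Supermanifold.{u}) : Type u := X.toGrSpace.carrier

/-- The map of supports underlying a morphism. -/
def Hom.base {X Y : Supermanifold.{u}} (f : X ⟶ Y) : C(X.supp, Y.supp) := GrHom.base f

/-- Pullback of functions over an open set. -/
def Hom.pull {X Y : Supermanifold.{u}} (f : X ⟶ Y) (V : Opens Y.supp) :
    Y.toGrSpace.sec V →ₐ[ℝ] X.toGrSpace.sec (Opens.comap (Hom.base f) V) := GrHom.pull f V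

/-- Pullback `f^*` of global functions. -/
def Hom.globalPull {X Y : Supermanifold.{u}} (f : X ⟶ Y) : Y.Fun →ₐ[ℝ] X.Fun := Hom.pull f ⊤

theorem Hom.globalPull_mem {X Y : Supermanifold.{u}} (f : X ⟶ Y) {k : ℤ} {h : Y.Fun}
    (hh : h ∈ Y.FunDeg k) : Hom.globalPull f h ∈ X.FunDeg k :=
  GrHom.pull_mem f ⊤ hh

/-- A surjective submersion: surjective on supports and, around each point of the source, given in
suitable charts by a coordinate projection. -/
structure IsSurjectiveSubmersion {X Y : Supermanifold.{u}} (f : X ⟶ Y) : Prop where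
  surjective : Function.Surjective (Hom.base f)
  local_projection : ∀ x : X.supp, ∃ (U : Opens (Body X.dim)) (V : Opens (Body Y.dim))
    (φ : GrHom (superdomain X.dim U) X.toGrSpace) (χ : GrHom (superdomain Y.dim V) Y.toGrSpace)
    (μ : GrHom (superdomain X.dim U) (superdomain Y.dim V)),
    φ.IsOpenImmersion ∧ χ.IsOpenImmersion ∧ x ∈ Set.range φ.base ∧ φ.comp f = μ.comp χ ∧
    (∃ c : Fin (Y.dim 0) ↪ Fin (X.dim 0), ∀ k,
      μ.pull ⊤ (superdomain.baseCoord V k) = superdomain.baseCoord U (c k)) ∧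
    ∀ i : {i : ℤ // i ≠ 0}, ∃ c : Fin (Y.dim i) ↪ Fin (X.dim i), ∀ k,
      μ.pull ⊤ (superdomain.genCoord V ⟨i, k⟩) = superdomain.genCoord U ⟨i, c k⟩

end Supermanifold

open Supermanifold

/-! ### Vector fields -/

/-- A vector field of degree `j`: a degree `j` derivation of the sheaf of functions. -/
@[ext]
structure VectorField (X : Supermanifold.{u}) (j : ℤ) where
  app : ∀ U : Opens X.supp, X.toGrSpace.sec U →ₗ[ℝ] X.toGrSpace.sec U
  app_mem : ∀ (U : Opens X.supp) {k : ℤ} {f : X.toGrSpace.sec U}, f ∈ X.toGrSpace.gr U k →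
    app U f ∈ X.toGrSpace.gr U (j + k)
  leibniz : ∀ (U : Opens X.supp) {k : ℤ} {f : X.toGrSpace.sec U} (g : X.toGrSpace.sec U),
    f ∈ X.toGrSpace.gr U k → app U (f * g) = app U f * g + (-1 : ℝ) ^ (j * k) • (f * app U g)
  app_res : ∀ {U V : Opens X.supp} (h : V ≤ U) (f : X.toGrSpace.sec U),
    app V (X.toGrSpace.res h f) = X.toGrSpace.res h (app U f)

namespace VectorField

/-- The bracket `[φ, ψ] = φψ - (-1)^{|φ||ψ|} ψφ`, as an operator on functions. -/
def bracket {X : Supermanifold.{u}} {i j : ℤ} (φ : VectorField X i) (ψ : VectorField X j)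
    (U : Opens X.supp) : X.toGrSpace.sec U →ₗ[ℝ] X.toGrSpace.sec U :=
  φ.app U ∘ₗ ψ.app U - (-1 : ℝ) ^ (i * j) • (ψ.app U ∘ₗ φ.app U)

/-- A homological vector field: of degree `1`, with `[φ, φ] = 0`. -/
def IsHomological {X : Supermanifold.{u}} (φ : VectorField X 1) : Prop :=
  ∀ U, bracket φ φ U = 0

/-- `φ` on `X` and `ψ` on `Y` are `μ`-related: `μ^* (ψ f) = φ (μ^* f)` for all functions `f`. -/
def Related {X Y : Supermanifold.{u}} (μ : X ⟶ Y) {j : ℤ} (φ : VectorField X j)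
    (ψ : VectorField Y j) : Prop :=
  ∀ (V : Opens Y.supp) (f : Y.toGrSpace.sec V),
    Hom.pull μ V (ψ.app V f) = φ.app _ (Hom.pull μ V f)

/-- The action of a degree `1` vector field on global functions of degree `k`. -/
def act {X : Supermanifold.{u}} (φ : VectorField X 1) (k : ℤ) :
    X.FunDeg k →ₗ[ℝ] X.FunDeg (k + 1) :=
  (φ.app ⊤).restrict fun _ hf => add_comm 1 k ▸ φ.app_mem ⊤ hf

end VectorField

/-! ### Supergroupoids -/

/-- A supergroupoid `𝒢 ⇉ ℳ`. The product `mul` of `(g, h)` is defined when `src g = tgt h`. -/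
structure Supergroupoid where
  /-- `ℳ` -/
  obj : Supermanifold.{u}
  /-- `𝒢` -/
  arr : Supermanifold.{u}
  src : arr ⟶ obj
  tgt : arr ⟶ obj
  src_submersion : IsSurjectiveSubmersion src
  tgt_submersion : IsSurjectiveSubmersion tgt
  /-- the fibre product `𝒢^{(2)}` -/
  arr₂ : Supermanifold.{u}
  p₁ : arr₂ ⟶ arr
  p₂ : arr₂ ⟶ arr
  isPullback : IsPullback p₁ p₂ src tgt
  mul : arr₂ ⟶ arr
  one : obj ⟶ arr
  inv : arr ⟶ arr
  mul_src : mul ≫ src = p₂ ≫ src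
  mul_tgt : mul ≫ tgt = p₁ ≫ tgt
  one_src : one ≫ src = 𝟙 obj
  one_tgt : one ≫ tgt = 𝟙 obj
  inv_src : inv ≫ src = tgt
  inv_tgt : inv ≫ tgt = src
  /-- associativity, in terms of `T`-valued points -/
  mul_assoc : ∀ {T : Supermanifold.{u}} (a b c : T ⟶ arr) (hab : a ≫ src = b ≫ tgt)
    (hbc : b ≫ src = c ≫ tgt),
    isPullback.lift (isPullback.lift a b hab ≫ mul) c
      (by rw [Category.assoc, mul_src, isPullback.lift_snd_assoc, hbc]) ≫ mul =
    isPullback.lift a (isPullback.lift b c hbc ≫ mul)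
      (by rw [Category.assoc, mul_tgt, isPullback.lift_fst_assoc, hab]) ≫ mul
  one_mul : isPullback.lift (tgt ≫ one) (𝟙 arr)
    (by rw [Category.assoc, one_src, Category.comp_id, Category.id_comp]) ≫ mul = 𝟙 arr
  mul_one : isPullback.lift (𝟙 arr) (src ≫ one)
    (by rw [Category.assoc, one_tgt, Category.comp_id, Category.id_comp]) ≫ mul = 𝟙 arr
  inv_mul : isPullback.lift inv (𝟙 arr) (by rw [inv_src, Category.id_comp]) ≫ mul = src ≫ one
  mul_inv : isPullback.lift (𝟙 arr) inv (by rw [inv_tgt, Category.id_comp]) ≫ mul = tgt ≫ one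

/-- A vector field on `𝒢` is multiplicative if there is a vector field on `𝒢^{(2)}` that is
`p₁`-, `p₂`- and `m`-related to it. -/
def Supergroupoid.IsMultiplicative (𝒢 : Supergroupoid.{u}) {j : ℤ} (ψ : VectorField 𝒢.arr j) :
    Prop :=
  ∃ ψ₂ : VectorField 𝒢.arr₂ j, VectorField.Related 𝒢.p₁ ψ₂ ψ ∧ VectorField.Related 𝒢.p₂ ψ₂ ψ ∧
    VectorField.Related 𝒢.mul ψ₂ ψ

/-- A `Q`-groupoid: a supergroupoid with a multiplicative homological vector field. -/
structure QGroupoid extends Supergroupoid.{u} where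
  ψ : VectorField arr 1
  homological : ψ.IsHomological
  multiplicative : toSupergroupoid.IsMultiplicative ψ

/-! ### The nerve -/

namespace Supergroupoid

variable (𝒢 : Supergroupoid.{u})

/-- A `T`-valued point of the space of compatible `(n+1)`-tuples `(g_1, …, g_{n+1})`. -/
def Compatible {n : ℕ} {T : Supermanifold.{u}} (a : Fin (n + 1) → (T ⟶ 𝒢.arr)) : Prop :=
  ∀ i : Fin n, a i.castSucc ≫ 𝒢.src = a i.succ ≫ 𝒢.tgt

/-- `X`, with the projections `π`, is the iterated fibre product `𝒢^{(n+1)}` of compatible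
`(n+1)`-tuples. -/
def IsTuples {n : ℕ} (X : Supermanifold.{u}) (π : Fin (n + 1) → (X ⟶ 𝒢.arr)) : Prop :=
  𝒢.Compatible π ∧ ∀ (T : Supermanifold.{u}) (a : Fin (n + 1) → (T ⟶ 𝒢.arr)), 𝒢.Compatible a →
    ∃! l : T ⟶ X, ∀ i, l ≫ π i = a i

/-- The nerve of `𝒢`, given by any choice of the fibre products `𝒢^{(q)}` for `q ≥ 3`. -/
structure Nerve where
  /-- `higher q` is `𝒢^{(q+3)}` -/
  higher : ℕ → Supermanifold.{u}
  proj : ∀ q, Fin (q + 3) → (higher q ⟶ 𝒢.arr)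
  isTuples : ∀ q, 𝒢.IsTuples (n := q + 2) (higher q) (proj q)

namespace Nerve

variable {𝒢} (N : 𝒢.Nerve)

/-- `𝒢^{(q)}`. -/
def level : ℕ → Supermanifold.{u}
  | 0 => 𝒢.obj
  | 1 => 𝒢.arr
  | 2 => 𝒢.arr₂
  | q + 3 => N.higher q

/-- The components `g_1, …, g_{q+1}` of a point of `𝒢^{(q+1)}`. -/
def entry : ∀ q, Fin (q + 1) → (N.level (q + 1) ⟶ 𝒢.arr)
  | 0 => fun _ => 𝟙 𝒢.arr
  | 1 => Fin.cases 𝒢.p₁ fun _ => 𝒢.p₂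
  | q + 2 => N.proj q

theorem isTuples_level : ∀ q, 𝒢.IsTuples (N.level (q + 1)) (N.entry q)
  | 0 => ⟨fun i => i.elim0, fun T a _ => ⟨a 0,
      fun i => by
        have h : i = 0 := Fin.ext (by omega)
        subst h
        exact Category.comp_id (a 0),
      fun l hl => by rw [← hl 0]; exact (Category.comp_id l).symm⟩⟩
  | 1 => by
    refine ⟨fun i => ?_, fun T a ha => ?_⟩
    · rw [Subsingleton.elim i 0]
      exact 𝒢.isPullback.w
    · refine ⟨𝒢.isPullback.lift (a 0) (a 1) (ha 0), ?_, ?_⟩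
      · intro i
        fin_cases i
        · exact 𝒢.isPullback.lift_fst _ _ _
        · exact 𝒢.isPullback.lift_snd _ _ _
      · intro l hl
        refine 𝒢.isPullback.hom_ext ?_ ?_
        · exact (hl 0).trans (𝒢.isPullback.lift_fst _ _ _).symm
        · exact (hl 1).trans (𝒢.isPullback.lift_snd _ _ _).symm
  | q + 2 => N.isTuples q

/-- The product `g_{j+1} g_{j+2}` of consecutive components. -/
def entryMul (q : ℕ) (j : Fin (q + 1)) : N.level (q + 2) ⟶ 𝒢.arr :=
  𝒢.isPullback.lift (N.entry (q + 1) j.castSucc) (N.entry (q + 1) j.succ)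
    ((N.isTuples_level (q + 1)).1 j) ≫ 𝒢.mul

/-- The components of `σ_i (g_1, …, g_{q+2})`: for `i = 0` this is `(g_2, …, g_{q+2})`, for
`0 < i < q + 2` it is `(g_1, …, g_i g_{i+1}, …, g_{q+2})`, and for `i = q + 2` it is
`(g_1, …, g_{q+1})`. -/
def faceEntry (q : ℕ) (i : Fin (q + 3)) (j : Fin (q + 1)) : N.level (q + 2) ⟶ 𝒢.arr :=
  if (j : ℕ) + 1 < i then N.entry (q + 1) j.castSucc
  else if (j : ℕ) + 1 = i then N.entryMul q j
  else N.entry (q + 1) j.succ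

theorem faceEntry_compatible (q : ℕ) (i : Fin (q + 3)) : 𝒢.Compatible (N.faceEntry q i) := by
  intro j
  have hc := (N.isTuples_level (q + 1)).1
  have hs : ∀ k, N.entryMul q k ≫ 𝒢.src = N.entry (q + 1) k.succ ≫ 𝒢.src := fun k => by
    rw [entryMul, Category.assoc, 𝒢.mul_src, 𝒢.isPullback.lift_snd_assoc]
  have ht : ∀ k, N.entryMul q k ≫ 𝒢.tgt = N.entry (q + 1) k.castSucc ≫ 𝒢.tgt := fun k => by
    rw [entryMul, Category.assoc, 𝒢.mul_tgt, 𝒢.isPullback.lift_fst_assoc]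
  have e : j.castSucc.succ = j.succ.castSucc := Fin.succ_castSucc j
  unfold faceEntry
  simp only [Fin.val_castSucc, Fin.val_succ]
  rcases lt_trichotomy ((j : ℕ) + 1 + 1) i with h | h | h
  · rw [if_pos (by omega), if_pos h, ← e]
    exact hc j.castSucc
  · rw [if_pos (by omega), if_neg (by omega), if_pos h, ht, ← e]
    exact hc j.castSucc
  · rw [if_neg (show ¬ (j : ℕ) + 1 + 1 < i by omega), if_neg (show ¬ (j : ℕ) + 1 + 1 = i by omega),
      if_neg (show ¬ (j : ℕ) + 1 < i by omega)]
    split_ifs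
    · rw [hs, e]
      exact hc j.succ
    · rw [e]
      exact hc j.succ

/-- The face maps `σ_i : 𝒢^{(q+1)} ⟶ 𝒢^{(q)}`, with `σ_0 = s` and `σ_1 = t` for `q = 0`. -/
def face : ∀ q, Fin (q + 2) → (N.level (q + 1) ⟶ N.level q)
  | 0 => Fin.cases 𝒢.src fun _ => 𝒢.tgt
  | q + 1 => fun i =>
    ((N.isTuples_level q).2 _ (N.faceEntry q i) (N.faceEntry_compatible q i)).choose

/-- The groupoid coboundary `δ = ∑ (-1)^i (σ_i)^* : C^∞(𝒢^{(q)}) → C^∞(𝒢^{(q+1)})`. -/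
def coboundary (q : ℕ) : (N.level q).Fun →ₗ[ℝ] (N.level (q + 1)).Fun :=
  ∑ i : Fin (q + 2), (-1 : ℝ) ^ (i : ℕ) • (Hom.globalPull (N.face q i)).toLinearMap

/-- The space of cochains `C^{k,q}(𝒢) = C^∞_k(𝒢^{(q)})`. -/
abbrev Cochain (k : ℤ) (q : ℕ) : Type u := (N.level q).FunDeg k

/-- The coboundary on functions of degree `k`. -/
def coboundaryDeg (k : ℤ) (q : ℕ) : N.Cochain k q →ₗ[ℝ] N.Cochain k (q + 1) :=
  (N.coboundary q).restrict fun f hf => by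
    rw [coboundary, LinearMap.sum_apply]
    exact Submodule.sum_mem _ fun i _ =>
      Submodule.smul_mem _ _ (Hom.globalPull_mem (N.face q i) hf)

end Nerve

end Supergroupoid

/-! ### Double complexes -/

section DoubleComplex

variable {C : ℤ → ℕ → Type u} [∀ p q, AddCommGroup (C p q)] [∀ p q, Module ℝ (C p q)]

/-- `(C, δ, d)` is a double complex (with commuting differentials). -/
structure IsDoubleComplex (d : ∀ p q, C p q →ₗ[ℝ] C (p + 1) q)
    (δ : ∀ p q, C p q →ₗ[ℝ] C p (q + 1)) : Prop where
  d_comp_d : ∀ p q, d (p + 1) q ∘ₗ d p q = 0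
  δ_comp_δ : ∀ p q, δ p (q + 1) ∘ₗ δ p q = 0
  comm : ∀ p q, δ (p + 1) q ∘ₗ d p q = d p (q + 1) ∘ₗ δ p q

/-- The operator `D = d + (-1)^p δ` on the direct sum of all `C^{p,q}`. -/
def totalDifferential (d : ∀ p q, C p q →ₗ[ℝ] C (p + 1) q)
    (δ : ∀ p q, C p q →ₗ[ℝ] C p (q + 1)) :
    (⨁ x : ℤ × ℕ, C x.1 x.2) →ₗ[ℝ] ⨁ x : ℤ × ℕ, C x.1 x.2 :=
  DirectSum.toModule ℝ (ℤ × ℕ) _ fun x =>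
    DirectSum.lof ℝ (ℤ × ℕ) (fun x => C x.1 x.2) (x.1 + 1, x.2) ∘ₗ d x.1 x.2 +
    (-1 : ℝ) ^ x.1 • DirectSum.lof ℝ (ℤ × ℕ) (fun x => C x.1 x.2) (x.1, x.2 + 1) ∘ₗ δ x.1 x.2

variable (C) in
/-- The part `⨁_{p+q=n} C^{p,q}` of total degree `n`. -/
def totalPart (n : ℤ) : Submodule ℝ (⨁ x : ℤ × ℕ, C x.1 x.2) :=
  ⨆ x : {x : ℤ × ℕ // x.1 + x.2 = n},
    LinearMap.range (DirectSum.lof ℝ (ℤ × ℕ) (fun x => C x.1 x.2) x.1)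

/-- `(⨁_{p+q=n} C^{p,q}, D)` is a cochain complex. -/
def IsTotalDifferential (D : (⨁ x : ℤ × ℕ, C x.1 x.2) →ₗ[ℝ] ⨁ x : ℤ × ℕ, C x.1 x.2) : Prop :=
  (∀ n, totalPart C n ≤ (totalPart C (n + 1)).comap D) ∧ D ∘ₗ D = 0

end DoubleComplex

end ZGraded

end

/-!
The proof rests on the odd line. For a supermanifold `X`, let `X[ε]` be its product with the line
whose coordinate `ε` has degree `-1`: its functions are the `a + ε b`, with `ε² = 0` and
`a ε = (-1)^{|a|} ε a`. It is again a supermanifold (`Supermanifold.eps`), because over a superdomain `ε`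
is just one more coordinate (`superdomain.epsIso`). Vector fields `φ` of degree `1` on `X` are the
same as morphisms `X[ε] → X`, `f ↦ f + ε φ(f)`, that restrict to the identity at `ε = 0`
(`VectorField.flow`, `VectorField.exists_flow_eq`), and `μ`-relatedness becomes commutativity of a
square of morphisms (`VectorField.related_iff`). Questions about vector fields on fibre products
are thus questions about morphisms into fibre products, and are settled by the universal property,
without any local description of `𝒢^{(q)}`:

* `𝒢^{(q)}[ε] → 𝒢^{(q)}` is determined by its components, which must be the composites
  `𝒢^{(q)}[ε] → 𝒢[ε] → 𝒢`. They are compatible as soon as `ψ` projects to one vector field on `ℳ` under both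
  source and target. This gives existence and uniqueness of `ψ^{(q)}` (`IsTuples.exists_related`,
  `VectorField.eq_of_jointlyMonic`). That `ψ` projects follows by restricting
  `p₁^*(ψ s^*f) = p₂^*(ψ t^*f)` to the pairs of arrows in which one is an identity
  (`IsMultiplicative.exists_related`).
* Relatedness under the face maps is also checked on components; for the products `g_i g_{i+1}` it
  is multiplicativity of `ψ` (`Nerve.related_face`).
* The square of `ψ^{(q)}` is a derivation of degree `2`. Derivations `χ` of degree `2` are
  morphisms `X[ε₁][ε₂] → X`, `f ↦ f + ε₂ ε₁ χ(f)` (`VectorField.flow₂`), and the one given by the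
  square has the same components as the one given by `0`
  (`VectorField.isHomological_of_jointlyMonic`).

Commutation of `ψ` with `δ` is relatedness, summed over the faces; `δ² = 0` follows from the
simplicial identities (`Nerve.face_comp_face`), the main case of which is associativity.
-/

noncomputable section

namespace ZGraded

/-! ### The parity involution of a graded algebra -/

section Parity

variable {A : Type*} [Ring A] [Algebra ℝ A] {gr : ℤ → Submodule ℝ A}

/-- An additive property holds for all elements of a graded algebra if it holds for the homogeneous
ones. -/
theorem induction_homogeneous (h : DirectSum.IsInternal gr) {P : A → Prop}
    (hom : ∀ k a, a ∈ gr k → P a) (add : ∀ a b, P a → P b → P (a + b)) (a : A) : P a := by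
  have ha : a ∈ iSup gr := by rw [h.submodule_iSup_eq_top]; trivial
  exact Submodule.iSup_induction gr (motive := P) ha hom (hom 0 0 (zero_mem _)) add

/-- The homogeneous component of degree `k`. -/
def component (h : DirectSum.IsInternal gr) (k : ℤ) : A →ₗ[ℝ] gr k :=
  DirectSum.component ℝ ℤ (fun k => gr k) k ∘ₗ
    (LinearEquiv.ofBijective (DirectSum.coeLinearMap gr) h).symm.toLinearMap

theorem ofBijective_symm_of_mem (h : DirectSum.IsInternal gr) {k : ℤ} {a : A} (ha : a ∈ gr k) :
    (LinearEquiv.ofBijective (DirectSum.coeLinearMap gr) h).symm a =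
      DirectSum.lof ℝ ℤ (fun k => gr k) k ⟨a, ha⟩ := by
  rw [LinearEquiv.symm_apply_eq]
  exact (DirectSum.coeLinearMap_lof gr k ⟨a, ha⟩).symm

theorem component_of_mem (h : DirectSum.IsInternal gr) {k : ℤ} {a : A} (ha : a ∈ gr k) :
    (component h k a : A) = a := by
  simp only [component, LinearMap.comp_apply, LinearEquiv.coe_coe, ofBijective_symm_of_mem h ha]
  rw [DirectSum.component.lof_self]

theorem component_of_mem_ne (h : DirectSum.IsInternal gr) {j k : ℤ} {a : A} (ha : a ∈ gr k)
    (hjk : j ≠ k) : component h j a = 0 := by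
  simp only [component, LinearMap.comp_apply, LinearEquiv.coe_coe, ofBijective_symm_of_mem h ha]
  exact DirectSum.of_eq_of_ne _ _ _ hjk

theorem exists_finset_component_eq_zero (h : DirectSum.IsInternal gr) (a : A) :
    ∃ F : Finset ℤ, ∀ k ∉ F, component h k a = 0 := by
  classical
  refine ⟨DFinsupp.support ((LinearEquiv.ofBijective (DirectSum.coeLinearMap gr) h).symm a),
    fun k hk => ?_⟩
  rw [DFinsupp.mem_support_iff, not_not] at hk
  exact hk

theorem eq_zero_of_component_eq_zero (h : DirectSum.IsInternal gr) (a : A)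
    (ha : ∀ k, component h k a = 0) : a = 0 := by
  rw [← LinearEquiv.map_eq_zero_iff (LinearEquiv.ofBijective (DirectSum.coeLinearMap gr) h).symm]
  exact DFinsupp.ext ha

/-- The involution `a ↦ (-1)^{|a|} a`, as a linear map. -/
def parityLin (h : DirectSum.IsInternal gr) : A →ₗ[ℝ] A :=
  DirectSum.toModule ℝ ℤ A (fun k => (-1 : ℝ) ^ k • (gr k).subtype) ∘ₗ
    (LinearEquiv.ofBijective (DirectSum.coeLinearMap gr) h).symm.toLinearMap

theorem parityLin_of_mem (h : DirectSum.IsInternal gr) {k : ℤ} {a : A} (ha : a ∈ gr k) :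
    parityLin h a = (-1 : ℝ) ^ k • a := by
  simp only [parityLin, LinearMap.comp_apply, LinearEquiv.coe_coe, ofBijective_symm_of_mem h ha]
  rw [DirectSum.toModule_lof]
  rfl

/-- The involution `a ↦ (-1)^{|a|} a` of a graded algebra. -/
def parity [SetLike.GradedMonoid gr] (h : DirectSum.IsInternal gr) : A →ₐ[ℝ] A :=
  AlgHom.ofLinearMap (parityLin h)
    (by rw [parityLin_of_mem h (SetLike.GradedOne.one_mem (A := gr)), zpow_zero, one_smul])
    (by
      intro a b
      induction a using induction_homogeneous h with
      | add a a' h1 h2 => rw [add_mul, map_add, map_add, add_mul, h1, h2]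
      | hom k a ha =>
        induction b using induction_homogeneous h with
        | add b b' h1 h2 => rw [mul_add, map_add, map_add, mul_add, h1, h2]
        | hom l b hb =>
          rw [parityLin_of_mem h ha, parityLin_of_mem h hb,
            parityLin_of_mem h (SetLike.GradedMul.mul_mem ha hb), smul_mul_smul_comm,
            zpow_add₀ (by norm_num)])

theorem parity_of_mem [SetLike.GradedMonoid gr] (h : DirectSum.IsInternal gr) {k : ℤ} {a : A}
    (ha : a ∈ gr k) : parity h a = (-1 : ℝ) ^ k • a :=
  parityLin_of_mem h ha

theorem parity_mem [SetLike.GradedMonoid gr] (h : DirectSum.IsInternal gr) {k : ℤ} {a : A}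
    (ha : a ∈ gr k) : parity h a ∈ gr k := by
  rw [parity_of_mem h ha]
  exact Submodule.smul_mem _ _ ha

/-- Homomorphisms of graded algebras commute with the parity involutions. -/
theorem map_parity [SetLike.GradedMonoid gr] (h : DirectSum.IsInternal gr)
    {B : Type*} [Ring B] [Algebra ℝ B] {gr' : ℤ → Submodule ℝ B} [SetLike.GradedMonoid gr']
    (h' : DirectSum.IsInternal gr') (f : A →ₐ[ℝ] B) (hf : ∀ {k a}, a ∈ gr k → f a ∈ gr' k) (a : A) :
    f (parity h a) = parity h' (f a) := by
  induction a using induction_homogeneous h with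
  | add a b h1 h2 => simp only [map_add, h1, h2]
  | hom k a ha => rw [parity_of_mem h ha, parity_of_mem h' (hf ha), map_smul]

end Parity

/-! ### Adjoining an odd variable -/

section Eps

variable {A : Type*} [Ring A] [Algebra ℝ A]

/-- The algebra `A[ε]` of elements `a + ε b`, with `ε² = 0` and `a ε = ε σ(a)`, encoded as the pairs
`(a, b)`. -/
@[ext, nolint unusedArguments]
structure EpsAlg (_σ : A →ₐ[ℝ] A) where
  fst : A
  snd : A

namespace EpsAlg

variable {σ : A →ₐ[ℝ] A}

/-- The underlying pairs, from which the module structure is transported. -/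
def equivProd (σ : A →ₐ[ℝ] A) : EpsAlg σ ≃ A × A where
  toFun x := (x.1, x.2)
  invFun x := ⟨x.1, x.2⟩
  left_inv _ := rfl
  right_inv _ := rfl

instance : AddCommGroup (EpsAlg σ) := (equivProd σ).addCommGroup
instance : Module ℝ (EpsAlg σ) := (equivProd σ).module ℝ
instance : Mul (EpsAlg σ) := ⟨fun x y => ⟨x.1 * y.1, x.2 * y.1 + σ x.1 * y.2⟩⟩
instance : One (EpsAlg σ) := ⟨⟨1, 0⟩⟩

@[simp] theorem fst_add (x y : EpsAlg σ) : (x + y).1 = x.1 + y.1 := rfl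
@[simp] theorem snd_add (x y : EpsAlg σ) : (x + y).2 = x.2 + y.2 := rfl
@[simp] theorem fst_zero : (0 : EpsAlg σ).1 = 0 := rfl
@[simp] theorem snd_zero : (0 : EpsAlg σ).2 = 0 := rfl
@[simp] theorem fst_smul (r : ℝ) (x : EpsAlg σ) : (r • x).1 = r • x.1 := rfl
@[simp] theorem snd_smul (r : ℝ) (x : EpsAlg σ) : (r • x).2 = r • x.2 := rfl
@[simp] theorem fst_mul (x y : EpsAlg σ) : (x * y).1 = x.1 * y.1 := rfl
@[simp] theorem snd_mul (x y : EpsAlg σ) : (x * y).2 = x.2 * y.1 + σ x.1 * y.2 := rfl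
@[simp] theorem fst_one : (1 : EpsAlg σ).1 = 1 := rfl
@[simp] theorem snd_one : (1 : EpsAlg σ).2 = 0 := rfl

instance : Ring (EpsAlg σ) where
  __ := (inferInstance : AddCommGroup (EpsAlg σ))
  mul_assoc x y z := by ext <;> simp [mul_assoc, add_mul, mul_add, add_assoc]
  one_mul x := by ext <;> simp
  mul_one x := by ext <;> simp
  left_distrib x y z := by ext <;> simp [mul_add]; abel
  right_distrib x y z := by ext <;> simp [add_mul]; abel
  zero_mul x := by ext <;> simp
  mul_zero x := by ext <;> simp

@[simp] theorem fst_neg (x : EpsAlg σ) : (-x).1 = -x.1 := rfl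
@[simp] theorem snd_neg (x : EpsAlg σ) : (-x).2 = -x.2 := rfl

instance : Algebra ℝ (EpsAlg σ) :=
  Algebra.ofModule (fun r x y => by ext <;> simp) (fun r x y => by ext <;> simp)

/-- The map `a + ε b ↦ a`. -/
def fstHom (σ : A →ₐ[ℝ] A) : EpsAlg σ →ₐ[ℝ] A where
  toFun x := x.1
  map_one' := rfl
  map_mul' _ _ := rfl
  map_zero' := rfl
  map_add' _ _ := rfl
  commutes' r := (Algebra.algebraMap_eq_smul_one r).symm

/-- A homomorphism `B → A[ε]` consists of its reduction `f` modulo `ε` and a skew derivation `D`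
along `f`. -/
def homMk {B : Type*} [Ring B] [Algebra ℝ B] (f : B →ₐ[ℝ] A) (D : B →ₗ[ℝ] A) (h1 : D 1 = 0)
    (h : ∀ a b, D (a * b) = D a * f b + σ (f a) * D b) : B →ₐ[ℝ] EpsAlg σ :=
  AlgHom.ofLinearMap
    { toFun := fun b => ⟨f b, D b⟩
      map_add' := fun a b => by ext <;> simp
      map_smul' := fun r a => by ext <;> simp }
    (EpsAlg.ext (map_one f) h1) (fun a b => EpsAlg.ext (map_mul f a b) (h a b))

/-- The homomorphism `a + ε b ↦ f a + ε (f b)`. -/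
def map {B : Type*} [Ring B] [Algebra ℝ B] {τ : B →ₐ[ℝ] B} (f : A →ₐ[ℝ] B)
    (h : ∀ a, f (σ a) = τ (f a)) : EpsAlg σ →ₐ[ℝ] EpsAlg τ :=
  AlgHom.ofLinearMap
    { toFun := fun x => ⟨f x.1, f x.2⟩
      map_add' := fun a b => by ext <;> simp
      map_smul' := fun r a => by ext <;> simp }
    (EpsAlg.ext (map_one f) (map_zero f)) (fun a b => by
      ext
      · exact map_mul f _ _
      · simp [h])

theorem map_bijective {B : Type*} [Ring B] [Algebra ℝ B] {τ : B →ₐ[ℝ] B} (f : A →ₐ[ℝ] B)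
    (h : ∀ a, f (σ a) = τ (f a)) (hf : Function.Bijective f) : Function.Bijective (map f h) := by
  refine ⟨fun x y hxy => ?_, fun y => ?_⟩
  · exact EpsAlg.ext (hf.1 (congrArg fst hxy)) (hf.1 (congrArg snd hxy))
  · obtain ⟨a, ha⟩ := hf.2 y.1
    obtain ⟨b, hb⟩ := hf.2 y.2
    exact ⟨⟨a, b⟩, EpsAlg.ext ha hb⟩

/-- The homomorphism `a + ε b ↦ f a + e (f b)` given by the image `e` of `ε`. -/
def lift {B : Type*} [Ring B] [Algebra ℝ B] (f : A →ₐ[ℝ] B) (e : B) (he : e * e = 0)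
    (h : ∀ a, f a * e = e * f (σ a)) : EpsAlg σ →ₐ[ℝ] B :=
  AlgHom.ofLinearMap
    { toFun := fun x => f x.1 + e * f x.2
      map_add' := fun x y => by simp only [fst_add, snd_add, map_add, mul_add]; abel
      map_smul' := fun r x => by simp }
    (by simp)
    (fun x y => by
      change f (x.1 * y.1) + e * f (x.2 * y.1 + σ x.1 * y.2) =
        (f x.1 + e * f x.2) * (f y.1 + e * f y.2)
      -- the terms in `ε²`
      have h0 : e * f x.2 * (e * f y.2) = 0 := by
        rw [← mul_assoc, mul_assoc e, h, ← mul_assoc e, he, zero_mul, zero_mul]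
      have h1 : f x.1 * (e * f y.2) = e * (f (σ x.1) * f y.2) := by
        rw [← mul_assoc, h, mul_assoc]
      rw [add_mul, mul_add, mul_add, h0, h1, map_add, map_mul, map_mul, map_mul, mul_add, add_zero,
        mul_assoc]
      abel)

theorem lift_apply {B : Type*} [Ring B] [Algebra ℝ B] (f : A →ₐ[ℝ] B) (e : B) (he : e * e = 0)
    (h : ∀ a, f a * e = e * f (σ a)) (x : EpsAlg σ) : lift f e he h x = f x.1 + e * f x.2 := rfl


/-- The grading of `A[ε]` for `|ε| = -1`: the element `a + ε b` has degree `k` if `|a| = k` and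
`|b| = k + 1`. -/
def grading (gr : ℤ → Submodule ℝ A) (σ : A →ₐ[ℝ] A) (k : ℤ) : Submodule ℝ (EpsAlg σ) where
  carrier := {x | x.1 ∈ gr k ∧ x.2 ∈ gr (k + 1)}
  add_mem' hx hy := ⟨add_mem hx.1 hy.1, add_mem hx.2 hy.2⟩
  zero_mem' := ⟨zero_mem _, zero_mem _⟩
  smul_mem' r _ hx := ⟨Submodule.smul_mem _ r hx.1, Submodule.smul_mem _ r hx.2⟩

variable {gr : ℤ → Submodule ℝ A}

theorem gradedMonoid [SetLike.GradedMonoid gr] (hσ : ∀ {k a}, a ∈ gr k → σ a ∈ gr k) :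
    SetLike.GradedMonoid (EpsAlg.grading gr σ) where
  one_mem := ⟨SetLike.GradedOne.one_mem, zero_mem _⟩
  mul_mem i j x y hx hy := by
    refine ⟨SetLike.GradedMul.mul_mem hx.1 hy.1, add_mem ?_ ?_⟩
    · have := SetLike.GradedMul.mul_mem hx.2 hy.1
      rwa [show i + 1 + j = i + j + 1 by ring] at this
    · have := SetLike.GradedMul.mul_mem (hσ hx.1) hy.2
      rwa [← add_assoc] at this

theorem isInternal (h : DirectSum.IsInternal gr) : DirectSum.IsInternal (EpsAlg.grading gr σ) := by
  let c (k : ℤ) : EpsAlg σ →ₗ[ℝ] EpsAlg.grading gr σ k :=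
    { toFun := fun x => ⟨⟨component h k x.1, component h (k + 1) x.2⟩,
        SetLike.coe_mem (component h k x.1), SetLike.coe_mem (component h (k + 1) x.2)⟩
      map_add' := fun x y => Subtype.ext (by ext <;> simp)
      map_smul' := fun r x => Subtype.ext (by ext <;> simp) }
  refine isInternal_of_components _ c ?_ ?_ ?_ ?_
  · intro k x hx
    exact EpsAlg.ext (component_of_mem h hx.1) (component_of_mem h hx.2)
  · intro j k x hx hjk
    refine Subtype.ext (EpsAlg.ext ?_ ?_)
    · exact congrArg Subtype.val (component_of_mem_ne h hx.1 hjk)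
    · exact congrArg Subtype.val (component_of_mem_ne h hx.2 (by omega))
  · intro x
    obtain ⟨F, hF⟩ := exists_finset_component_eq_zero h x.1
    obtain ⟨G, hG⟩ := exists_finset_component_eq_zero h x.2
    refine ⟨F ∪ G.image (· - 1), fun k hk => Subtype.ext (EpsAlg.ext ?_ ?_)⟩
    · exact congrArg Subtype.val (hF k fun h => hk (Finset.mem_union_left _ h))
    · refine congrArg Subtype.val (hG (k + 1) fun h => hk (Finset.mem_union_right _ ?_))
      exact Finset.mem_image.2 ⟨k + 1, h, by ring⟩
  · intro x hx
    refine EpsAlg.ext (eq_zero_of_component_eq_zero h _ fun k => Subtype.ext ?_)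
      (eq_zero_of_component_eq_zero h _ fun k => Subtype.ext ?_)
    · exact congrArg (fun y => y.1.1) (hx k)
    · obtain ⟨k, rfl⟩ : ∃ j, k = j + 1 := ⟨k - 1, by ring⟩
      exact congrArg (fun y => y.1.2) (hx k)

end EpsAlg

end Eps

/-! ### Adjoining an odd variable to a space -/

/-- Equality of morphisms, where the restrictions absorb the dependence of the type of `pull` on the
underlying map. -/
theorem GrHom.ext_of_res {X : GrSpace.{u}} {Y : GrSpace.{v}} {f g : GrHom X Y}
    (hb : f.base = g.base)
    (h : ∀ (V : Opens Y.carrier) (s : Y.sec V), X.res (V := Opens.comap g.base V)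
      (by rw [hb]) (f.pull V s) = g.pull V s) : f = g := by
  obtain ⟨b, pf, _, _⟩ := f
  obtain ⟨b', pg, _, _⟩ := g
  obtain rfl : b = b' := hb
  congr 1
  funext V
  ext s
  rw [← h V s]
  exact (X.res_refl _).symm

theorem GrHom.pull_congr {X : GrSpace.{u}} {Y : GrSpace.{v}} {f g : GrHom X Y} (h : f = g)
    (V : Opens Y.carrier) (s : Y.sec V) :
    f.pull V s = X.res (V := Opens.comap f.base V) (by rw [h]) (g.pull V s) := by
  subst h
  exact (X.res_refl _).symm

namespace GrSpace

/-- The involution `f ↦ (-1)^{|f|} f` on sections. -/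
def parity (X : GrSpace.{u}) (U : Opens X.carrier) : X.sec U →ₐ[ℝ] X.sec U :=
  ZGraded.parity (X.isInternal U)

theorem parity_of_mem (X : GrSpace.{u}) {U : Opens X.carrier} {k : ℤ} {f : X.sec U}
    (hf : f ∈ X.gr U k) : X.parity U f = (-1 : ℝ) ^ k • f :=
  ZGraded.parity_of_mem _ hf

theorem parity_mem (X : GrSpace.{u}) {U : Opens X.carrier} {k : ℤ} {f : X.sec U}
    (hf : f ∈ X.gr U k) : X.parity U f ∈ X.gr U k :=
  ZGraded.parity_mem _ hf

theorem res_parity (X : GrSpace.{u}) {U V : Opens X.carrier} (h : V ≤ U) (f : X.sec U) :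
    X.res h (X.parity U f) = X.parity V (X.res h f) :=
  map_parity _ _ _ (X.res_mem h) f

theorem _root_.ZGraded.GrHom.pull_parity {X : GrSpace.{u}} {Y : GrSpace.{v}} (f : GrHom X Y)
    (V : Opens Y.carrier) (s : Y.sec V) :
    f.pull V (Y.parity V s) = X.parity _ (f.pull V s) :=
  map_parity _ _ _ (f.pull_mem V) s

/-- The space `X[ε]` (the product of `X` with the odd line), with one more coordinate `ε`, of degree
`-1`. A morphism from it is an infinitesimal deformation, of degree `1`, of a morphism from `X`. -/
abbrev eps (X : GrSpace.{u}) : GrSpace.{u} where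
  carrier := X.carrier
  sec U := EpsAlg (X.parity U)
  gr U := EpsAlg.grading (X.gr U) (X.parity U)
  gradedMonoid U := EpsAlg.gradedMonoid X.parity_mem
  isInternal U := EpsAlg.isInternal (X.isInternal U)
  res h := EpsAlg.map (X.res h) (X.res_parity h)
  res_mem h _ _ hf := ⟨X.res_mem h hf.1, X.res_mem h hf.2⟩
  res_refl f := EpsAlg.ext (X.res_refl _) (X.res_refl _)
  res_res h h' f := EpsAlg.ext (X.res_res h h' _) (X.res_res h h' _)
  glue V hV hcov k f hf hcomp := by
    obtain ⟨a, ⟨ha, ha'⟩, ua⟩ := X.glue V hV hcov k (fun i => (f i).1) (fun i => (hf i).1)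
      (fun i j => congrArg EpsAlg.fst (hcomp i j))
    obtain ⟨b, ⟨hb, hb'⟩, ub⟩ := X.glue V hV hcov (k + 1) (fun i => (f i).2) (fun i => (hf i).2)
      (fun i j => congrArg EpsAlg.snd (hcomp i j))
    refine ⟨⟨a, b⟩, ⟨⟨ha, hb⟩, fun i => EpsAlg.ext (ha' i) (hb' i)⟩, ?_⟩
    rintro g ⟨hg, hg'⟩
    exact EpsAlg.ext (ua g.1 ⟨hg.1, fun i => congrArg EpsAlg.fst (hg' i)⟩)
      (ub g.2 ⟨hg.2, fun i => congrArg EpsAlg.snd (hg' i)⟩)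

/-- The inclusion of `X` into `X[ε]` as the subspace `ε = 0`. -/
def epsZero (X : GrSpace.{u}) : GrHom X X.eps where
  base := ContinuousMap.id _
  pull := fun V : Opens X.carrier => EpsAlg.fstHom (X.parity V)
  pull_mem _ _ _ h := h.1
  pull_res _ _ := rfl

end GrSpace

namespace GrHom

/-- The morphism `X[ε] → Y[ε]` given by a morphism `X → Y` and `ε ↦ ε`. -/
def eps {X : GrSpace.{u}} {Y : GrSpace.{v}} (f : GrHom X Y) : GrHom X.eps Y.eps where
  base := f.base
  pull := fun V : Opens Y.carrier => (EpsAlg.map (f.pull V) (f.pull_parity V) :)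
  pull_mem V _ _ h := ⟨f.pull_mem V h.1, f.pull_mem V h.2⟩
  pull_res h _ := @EpsAlg.ext _ _ _ (X.parity _) _ _ (f.pull_res h _) (f.pull_res h _)

theorem IsOpenImmersion.eps {X : GrSpace.{u}} {Y : GrSpace.{v}} {f : GrHom X Y}
    (hf : f.IsOpenImmersion) : f.eps.IsOpenImmersion :=
  ⟨hf.1, fun (V : Opens Y.carrier) hV =>
    (EpsAlg.map_bijective (f.pull V) (f.pull_parity V) (hf.2 V hV) :)⟩

/-- The composite of an isomorphism with an open immersion. -/
theorem IsOpenImmersion.comp {X : GrSpace.{u}} {Y : GrSpace.{v}} {Z : GrSpace.{w}} {f : GrHom X Y}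
    {g : GrHom Y Z} (hf : f.IsOpenImmersion) (hg : g.IsOpenImmersion)
    (hsurj : Function.Surjective f.base) : (f.comp g).IsOpenImmersion := by
  refine ⟨hg.1.comp hf.1, fun V hV => ?_⟩
  have h1 : (V : Set Z.carrier) ⊆ Set.range g.base := by
    intro z hz
    obtain ⟨x, hx⟩ := hV hz
    exact ⟨f.base x, hx⟩
  exact (hf.2 (Opens.comap g.base V) fun y _ => hsurj y).comp (hg.2 V h1)

end GrHom

/-! ### Adjoining an odd variable to a superdomain -/

/-- The dimension `p` with one more coordinate of degree `-1`. -/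
def addOdd (p : ℤ → ℕ) (i : ℤ) : ℕ := p i + if i = 1 then 1 else 0

theorem addOdd_zero (p : ℤ → ℕ) : addOdd p 0 = p 0 := by simp [addOdd]

theorem addOdd_one (p : ℤ → ℕ) : addOdd p 1 = p 1 + 1 := by simp [addOdd]

/-- Adding an odd coordinate does not change the underlying space. -/
def bodyEquiv (p : ℤ → ℕ) : Body (addOdd p) ≃L[ℝ] Body p :=
  (LinearIsometryEquiv.piLpCongrLeft 2 ℝ ℝ (finCongr (addOdd_zero p))).toContinuousLinearEquiv

namespace Gen

variable {p : ℤ → ℕ}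

/-- The coordinates of dimension `p` among those of dimension `addOdd p`. -/
def old (x : Gen p) : Gen (addOdd p) := ⟨x.1, Fin.castLE (Nat.le_add_right _ _) x.2⟩

/-- The additional coordinate `ε`. -/
def new (p : ℤ → ℕ) : Gen (addOdd p) :=
  ⟨⟨1, one_ne_zero⟩, ⟨p 1, by rw [addOdd_one]; exact Nat.lt_succ_self _⟩⟩

@[simp] theorem deg_old (x : Gen p) : x.old.deg = x.deg := rfl

@[simp] theorem deg_new : (new p).deg = -1 := rfl

theorem eq_old_or_eq_new (x : Gen (addOdd p)) : (∃ y : Gen p, x = y.old) ∨ x = new p := by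
  obtain ⟨⟨i, hi⟩, k, hk⟩ := x
  by_cases h : k < p i
  · exact Or.inl ⟨⟨⟨i, hi⟩, ⟨k, h⟩⟩, rfl⟩
  · right
    by_cases h1 : i = 1
    · subst h1
      obtain rfl : k = p 1 := by
        have := hk
        simp only [addOdd_one] at this
        omega
      rfl
    · simp only [addOdd, if_neg h1] at hk
      omega

/-- A family indexed by the coordinates of dimension `p`, extended by a value at `ε`. -/
def extend {B : Type*} (f : Gen p → B) (e : B) (x : Gen (addOdd p)) : B :=
  if h : (x.2 : ℕ) < p x.1 then f ⟨x.1, ⟨x.2, h⟩⟩ else e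

@[simp] theorem extend_old {B : Type*} (f : Gen p → B) (e : B) (x : Gen p) :
    extend f e x.old = f x := dif_pos x.2.2

@[simp] theorem extend_new {B : Type*} (f : Gen p → B) (e : B) : extend f e (new p) = e :=
  dif_neg (lt_irrefl _)

end Gen

namespace GCAlg

variable {p q : ℤ → ℕ}

theorem isInternal (p : ℤ → ℕ) : DirectSum.IsInternal (gr p) :=
  DirectSum.Decomposition.isInternal (gr p)

/-- An algebra homomorphism is homogeneous if it is so on the coordinates. -/
theorem map_mem {B : Type*} [Ring B] [Algebra ℝ B] {gr' : ℤ → Submodule ℝ B}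
    [SetLike.GradedMonoid gr'] (φ : GCAlg p →ₐ[ℝ] B) (h : ∀ x, φ (gen x) ∈ gr' x.deg)
    {k : ℤ} {a : GCAlg p} (ha : a ∈ gr p k) : φ a ∈ gr' k := by
  induction ha using Submodule.span_induction with
  | mem y hy =>
    obtain ⟨l, rfl, rfl⟩ := hy
    induction l with
    | nil => simpa using SetLike.GradedOne.one_mem (A := gr')
    | cons a l ih => simpa using SetLike.GradedMul.mul_mem (h a) ih
  | zero => simp
  | add y z _ _ h1 h2 => rw [map_add]; exact add_mem h1 h2
  | smul r y _ h1 => rw [map_smul]; exact Submodule.smul_mem _ _ h1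

/-- A linear map of degree `d` commutes with the projections to homogeneous components. -/
theorem proj_map (T : GCAlg p →ₗ[ℝ] GCAlg q) (d : ℤ)
    (hT : ∀ {k a}, a ∈ gr p k → T a ∈ gr q (k + d)) (k : ℤ) (a : GCAlg p) :
    GradedAlgebra.proj (gr q) (k + d) (T a) = T (GradedAlgebra.proj (gr p) k a) := by
  induction a using induction_homogeneous (isInternal p) with
  | add a b h1 h2 => simp only [map_add, h1, h2]
  | hom l a ha =>
    simp only [GradedAlgebra.proj_apply]
    by_cases h : l = k
    · subst h
      rw [DirectSum.decompose_of_mem_same _ ha, DirectSum.decompose_of_mem_same _ (hT ha)]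
    · rw [DirectSum.decompose_of_mem_ne _ ha h, DirectSum.decompose_of_mem_ne _ (hT ha) (by omega),
        map_zero]

/-- The inclusion `ℝ[ξ] → ℝ[ξ, ε]`. -/
def incl (p : ℤ → ℕ) : GCAlg p →ₐ[ℝ] GCAlg (addOdd p) :=
  lift (fun x => gen x.old) fun x y => gen_mul_gen x.old y.old

theorem incl_gen (x : Gen p) : incl p (gen x) = gen x.old := lift_gen _ _ x

theorem incl_mem {k : ℤ} {a : GCAlg p} (ha : a ∈ gr p k) : incl p a ∈ gr (addOdd p) k :=
  map_mem (incl p) (fun x => by rw [incl_gen]; exact gen_mem x.old) ha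

theorem gen_new_mul_self : gen (Gen.new p) * gen (Gen.new p) = 0 := by
  have h := gen_mul_gen (Gen.new p) (Gen.new p)
  simp only [Gen.deg_new] at h
  norm_num only [zpow_one, neg_smul, one_smul] at h
  have h2 : (2 : ℝ) • (gen (Gen.new p) * gen (Gen.new p)) = 0 := by
    rw [two_smul]
    nth_rewrite 1 [h]
    exact neg_add_cancel _
  exact (smul_eq_zero_iff_right two_ne_zero).1 h2

theorem gen_mul_gen_new (x : Gen (addOdd p)) :
    gen x * gen (Gen.new p) = (-1 : ℝ) ^ x.deg • (gen (Gen.new p) * gen x) := by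
  rw [gen_mul_gen, Gen.deg_new, mul_neg_one, zpow_neg, ← inv_zpow]
  norm_num

theorem incl_mul_gen_new {k : ℤ} {a : GCAlg p} (ha : a ∈ gr p k) :
    incl p a * gen (Gen.new p) = (-1 : ℝ) ^ k • (gen (Gen.new p) * incl p a) := by
  induction ha using Submodule.span_induction with
  | mem y hy =>
    obtain ⟨l, rfl, rfl⟩ := hy
    induction l with
    | nil => simp
    | cons a l ih =>
      simp only [List.map_cons, List.prod_cons, List.sum_cons, map_mul]
      rw [mul_assoc, ih, mul_smul_comm, ← mul_assoc, incl_gen, gen_mul_gen_new,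
        smul_mul_assoc, smul_smul, mul_assoc, Gen.deg_old, zpow_add₀ (by norm_num), mul_comm]
  | zero => simp
  | add y z _ _ h1 h2 => rw [map_add, add_mul, mul_add, smul_add, h1, h2]
  | smul r y _ h1 => rw [map_smul, smul_mul_assoc, mul_smul_comm, h1, smul_comm]

/-- The relation `a ε = ε σ(a)` of `EpsAlg`, for the parity involution `σ`, holds in `ℝ[ξ, ε]`. -/
theorem incl_mul_gen_new' (a : GCAlg p) : incl p a * gen (Gen.new p) =
    gen (Gen.new p) * incl p (parity (isInternal p) a) := by
  induction a using induction_homogeneous (isInternal p) with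
  | add a b h1 h2 => simp only [map_add, add_mul, mul_add, h1, h2]
  | hom k a ha => rw [incl_mul_gen_new ha, parity_of_mem _ ha, map_smul, mul_smul_comm]

/-- The map `a + ε b ↦ a + ε b` from `ℝ[ξ][ε]` to `ℝ[ξ, ε]`. -/
def ofEps (p : ℤ → ℕ) : EpsAlg (parity (isInternal p)) →ₐ[ℝ] GCAlg (addOdd p) :=
  EpsAlg.lift (incl p) (gen (Gen.new p)) gen_new_mul_self incl_mul_gen_new'

/-- The inverse map, from `ℝ[ξ, ε]` to `ℝ[ξ][ε]`, given by the universal property of `ℝ[ξ, ε]`. -/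
def toEps (p : ℤ → ℕ) : GCAlg (addOdd p) →ₐ[ℝ] EpsAlg (parity (isInternal p)) :=
  lift (Gen.extend (fun x => ⟨gen x, 0⟩) ⟨0, 1⟩) (by
    intro x y
    obtain ⟨x, rfl⟩ | rfl := x.eq_old_or_eq_new <;> obtain ⟨y, rfl⟩ | rfl := y.eq_old_or_eq_new
    · simp only [Gen.extend_old, Gen.deg_old]
      refine EpsAlg.ext (gen_mul_gen x y) ?_
      simp
    · simp only [Gen.extend_old, Gen.extend_new, Gen.deg_old, Gen.deg_new]
      refine EpsAlg.ext ?_ ?_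
      · simp
      · simp [parity_of_mem _ (gen_mem x), ← inv_zpow]
    · simp only [Gen.extend_old, Gen.extend_new, Gen.deg_old, Gen.deg_new]
      refine EpsAlg.ext ?_ ?_
      · simp
      · simp [parity_of_mem _ (gen_mem y), ← inv_zpow, smul_smul, ← mul_zpow]
    · simp only [Gen.extend_new]
      refine EpsAlg.ext ?_ ?_ <;> simp)

/-- The coefficient of `1` in an element of `ℝ[ξ, ε]`. -/
def toEpsFst (p : ℤ → ℕ) : GCAlg (addOdd p) →ₗ[ℝ] GCAlg p where
  toFun a := (toEps p a).1
  map_add' a b := by simp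
  map_smul' r a := by simp

/-- The coefficient of `ε` in an element of `ℝ[ξ, ε]`. -/
def toEpsSnd (p : ℤ → ℕ) : GCAlg (addOdd p) →ₗ[ℝ] GCAlg p where
  toFun a := (toEps p a).2
  map_add' a b := by simp
  map_smul' r a := by simp

theorem toEps_old (x : Gen p) : toEps p (gen x.old) = ⟨gen x, 0⟩ := by
  rw [toEps, lift_gen, Gen.extend_old]

theorem toEps_new : toEps p (gen (Gen.new p)) = ⟨0, 1⟩ := by
  rw [toEps, lift_gen, Gen.extend_new]

theorem ofEps_toEps (a : GCAlg (addOdd p)) : ofEps p (toEps p a) = a := by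
  refine DFunLike.congr_fun (hom_ext (f := (ofEps p).comp (toEps p)) (g := AlgHom.id ℝ _) ?_) a
  intro x
  rw [AlgHom.comp_apply, AlgHom.id_apply]
  obtain ⟨x, rfl⟩ | rfl := x.eq_old_or_eq_new
  · rw [toEps_old, ofEps, EpsAlg.lift_apply, map_zero, mul_zero, add_zero, incl_gen]
  · rw [toEps_new, ofEps, EpsAlg.lift_apply, map_zero, zero_add, map_one, mul_one]

theorem toEps_incl (a : GCAlg p) : toEps p (incl p a) = ⟨a, 0⟩ := by
  let inl : GCAlg p →ₐ[ℝ] EpsAlg (parity (isInternal p)) :=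
    EpsAlg.homMk (AlgHom.id ℝ _) 0 rfl (by simp)
  refine DFunLike.congr_fun (hom_ext (f := (toEps p).comp (incl p)) (g := inl) ?_) a
  intro x
  rw [AlgHom.comp_apply, incl_gen, toEps_old]
  rfl

theorem toEps_ofEps (x : EpsAlg (parity (isInternal p))) : toEps p (ofEps p x) = x := by
  rw [ofEps, EpsAlg.lift_apply, map_add, map_mul, toEps_incl, toEps_incl, toEps_new]
  refine EpsAlg.ext ?_ ?_ <;> simp

theorem toEps_mem {k : ℤ} {a : GCAlg (addOdd p)} (ha : a ∈ gr (addOdd p) k) :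
    toEps p a ∈ EpsAlg.grading (gr p) (parity (isInternal p)) k := by
  have := EpsAlg.gradedMonoid (gr := gr p) (σ := parity (isInternal p)) (parity_mem (isInternal p))
  refine map_mem (toEps p) (fun x => ?_) ha
  obtain ⟨x, rfl⟩ | rfl := x.eq_old_or_eq_new
  · rw [toEps_old]
    exact ⟨gen_mem x, zero_mem _⟩
  · rw [toEps_new]
    exact ⟨zero_mem _, SetLike.GradedOne.one_mem (A := gr p)⟩

end GCAlg

section

variable {p q : ℤ → ℕ} {U : Opens (Body p)} {U' : Opens (Body q)} {W : Opens U} {W' : Opens U'}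

/-- A section of a superdomain, transported along a linear map of the underlying spaces and a
homogeneous linear map of the algebras of coordinates. -/
def SDSec.transport (e : Body q →L[ℝ] Body p) (c : W' → W)
    (hc : ∀ y, ((c y : U) : Body p) = e ((y : U') : Body q)) (T : GCAlg p →ₗ[ℝ] GCAlg q) (d : ℤ)
    (hT : ∀ {k a}, a ∈ GCAlg.gr p k → T a ∈ GCAlg.gr q (k + d)) (f : SDSec W) : SDSec W' :=
  ⟨fun y => T (f.1 (c y)), by
    obtain ⟨hf, F, hF⟩ := f.2
    refine ⟨fun x => ?_, F.image (· + d), fun y k hk => ?_⟩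
    · obtain ⟨N, hN, hx, ι, _, g, s, hg, h⟩ := hf (c x)
      refine ⟨e ⁻¹' N, hN.preimage e.continuous, ?_, ι, inferInstance, fun a y => g a (e y),
        fun a => T (s a), fun a => ?_, fun y hy => ?_⟩
      · rw [Set.mem_preimage, ← hc]
        exact hx
      · exact (hg a).comp e.contDiff.contDiffOn fun _ h => h
      · have hcy : ((c y : U) : Body p) ∈ N := (hc y).symm ▸ hy
        beta_reduce
        rw [h (c y) hcy, map_sum]
        simp only [map_smul, hc]
    · obtain ⟨k, rfl⟩ : ∃ j, k = j + d := ⟨k - d, by ring⟩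
      rw [GCAlg.proj_map T d hT, hF _ k fun h => hk (Finset.mem_image_of_mem _ h), map_zero]⟩

end

namespace superdomain

variable (p : ℤ → ℕ) (U : Opens (Body p))

/-- The open set underlying the superdomain with one more odd coordinate. -/
abbrev epsDomain : Opens (Body (addOdd p)) :=
  Opens.comap ⟨bodyEquiv p, (bodyEquiv p).continuous⟩ U

/-- The identification of the supports. -/
def epsHomeo : epsDomain p U ≃ₜ U :=
  (bodyEquiv p).toHomeomorph.subtype fun _ => Iff.rfl

/-- The preimage of an open subset. -/
abbrev epsPreimage (W : Opens U) : Opens (epsDomain p U) :=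
  Opens.comap ⟨epsHomeo p U, (epsHomeo p U).continuous⟩ W

variable {p U}

/-- Pullback of superfunctions along the projection forgetting `ε`. -/
def inclSec (W : Opens U) : (superdomain p U).sec W →ₐ[ℝ] SDSec (epsPreimage p U W) where
  toFun := SDSec.transport (bodyEquiv p : Body (addOdd p) →L[ℝ] Body p)
    (fun y => ⟨epsHomeo p U y, y.2⟩) (fun _ => rfl) (GCAlg.incl p).toLinearMap 0
    (fun h => by rw [add_zero]; exact GCAlg.incl_mem h)
  map_one' := Subtype.ext (funext fun _ => map_one (GCAlg.incl p))
  map_mul' _ _ := Subtype.ext (funext fun _ => map_mul (GCAlg.incl p) _ _)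
  map_zero' := Subtype.ext (funext fun _ => map_zero (GCAlg.incl p))
  map_add' _ _ := Subtype.ext (funext fun _ => map_add (GCAlg.incl p) _ _)
  commutes' r := Subtype.ext (funext fun _ => (GCAlg.incl p).commutes r)

/-- The map `f + ε g ↦ f + ε g`, from pairs of superfunctions to superfunctions in one more
coordinate. -/
def epsSec (W : Opens U) :
    EpsAlg ((superdomain p U).parity W) →ₐ[ℝ] SDSec (epsPreimage p U W) :=
  EpsAlg.lift (inclSec W) (const _ (GCAlg.gen (Gen.new p)))
    (by rw [← map_mul, GCAlg.gen_new_mul_self, map_zero])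
    (fun a => by
      induction a using induction_homogeneous ((superdomain p U).isInternal W) with
      | add a b h1 h2 => simp only [map_add, add_mul, mul_add, h1, h2]
      | hom k a ha =>
        rw [(superdomain p U).parity_of_mem ha, map_smul, mul_smul_comm]
        exact Subtype.ext (funext fun y => GCAlg.incl_mul_gen_new (ha _)))

theorem epsSec_apply (W : Opens U) (x : EpsAlg ((superdomain p U).parity W))
    (y : epsPreimage p U W) : (epsSec W x).1 y =
      GCAlg.ofEps p ⟨x.1.1 ⟨epsHomeo p U y, y.2⟩, x.2.1 ⟨epsHomeo p U y, y.2⟩⟩ := rfl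

/-- The inverse of `epsSec`. -/
def epsSecInv (W : Opens U) (f : SDSec (epsPreimage p U W)) :
    EpsAlg ((superdomain p U).parity W) :=
  ⟨SDSec.transport ((bodyEquiv p).symm : Body p →L[ℝ] Body (addOdd p))
    (fun y => ⟨(epsHomeo p U).symm y, by
      change epsHomeo p U ((epsHomeo p U).symm y) ∈ W
      rw [Homeomorph.apply_symm_apply]; exact y.2⟩) (fun _ => rfl)
    (GCAlg.toEpsFst p) 0
    (fun h => by rw [add_zero]; exact (GCAlg.toEps_mem h).1) f,
  SDSec.transport ((bodyEquiv p).symm : Body p →L[ℝ] Body (addOdd p))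
    (fun y => ⟨(epsHomeo p U).symm y, by
      change epsHomeo p U ((epsHomeo p U).symm y) ∈ W
      rw [Homeomorph.apply_symm_apply]; exact y.2⟩) (fun _ => rfl)
    (GCAlg.toEpsSnd p) 1
    (fun h => (GCAlg.toEps_mem h).2) f⟩

theorem epsSec_bijective (W : Opens U) : Function.Bijective (epsSec (p := p) W) := by
  refine Function.bijective_iff_has_inverse.2 ⟨epsSecInv W, fun x => ?_, fun f => ?_⟩
  · have h : ∀ y : W, GCAlg.toEps p ((epsSec W x).1 ⟨(epsHomeo p U).symm y, by
        change epsHomeo p U ((epsHomeo p U).symm y) ∈ W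
        rw [Homeomorph.apply_symm_apply]; exact y.2⟩) = ⟨x.1.1 y, x.2.1 y⟩ := by
      intro y
      rw [epsSec_apply, GCAlg.toEps_ofEps]
      simp only [Homeomorph.apply_symm_apply]
    exact EpsAlg.ext (Subtype.ext (funext fun y => congrArg EpsAlg.fst (h y)))
      (Subtype.ext (funext fun y => congrArg EpsAlg.snd (h y)))
  · refine Subtype.ext (funext fun y => ?_)
    rw [epsSec_apply]
    refine (GCAlg.ofEps_toEps _).trans ?_
    simp only [Homeomorph.symm_apply_apply]

/-- The superdomain with one more odd coordinate, as the superdomain with `ε` adjoined. -/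
def epsIso (p : ℤ → ℕ) (U : Opens (Body p)) :
    GrHom (superdomain (addOdd p) (epsDomain p U)) (superdomain p U).eps where
  base := ⟨epsHomeo p U, (epsHomeo p U).continuous⟩
  pull := fun W : Opens U => epsSec W
  pull_mem W k f hf y := add_mem (GCAlg.incl_mem (hf.1 _)) (by
    have := SetLike.GradedMul.mul_mem (GCAlg.gen_mem (Gen.new p)) (GCAlg.incl_mem (hf.2
      ⟨epsHomeo p U y, y.2⟩))
    rwa [Gen.deg_new, show -1 + (k + 1) = k by ring] at this)
  pull_res _ _ := rfl

theorem epsIso_isOpenImmersion (p : ℤ → ℕ) (U : Opens (Body p)) :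
    (epsIso p U).IsOpenImmersion :=
  ⟨(epsHomeo p U).isOpenEmbedding, fun W _ => epsSec_bijective W⟩

end superdomain

namespace Supermanifold

/-- The supermanifold `X[ε]`, with `ε` of degree `-1`. Its charts are those of `X`, with `ε` as an
additional coordinate. -/
abbrev eps (X : Supermanifold.{u}) : Supermanifold.{u} where
  toGrSpace := X.toGrSpace.eps
  dim := addOdd X.dim
  locally_superdomain x := by
    obtain ⟨U, φ, hφ, y, rfl⟩ := X.locally_superdomain x
    refine ⟨superdomain.epsDomain X.dim U, (superdomain.epsIso X.dim U).comp φ.eps,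
      (superdomain.epsIso_isOpenImmersion X.dim U).comp hφ.eps
        (superdomain.epsHomeo X.dim U).surjective, (superdomain.epsHomeo X.dim U).symm y, ?_⟩
    exact congrArg φ.base ((superdomain.epsHomeo X.dim U).apply_symm_apply y)

end Supermanifold

/-! ### Vector fields as infinitesimal deformations of the identity -/

namespace Supermanifold

/-- The functor `X ↦ X[ε]`. -/
def epsFunctor : Supermanifold.{u} ⥤ Supermanifold.{u} where
  obj X := X.eps
  map f := GrHom.eps f
  map_id _ := rfl
  map_comp _ _ := rfl

/-- The inclusion of `X` into `X[ε]`, as a natural transformation. -/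
def epsZero : 𝟭 Supermanifold.{u} ⟶ epsFunctor where
  app X := GrSpace.epsZero X.toGrSpace
  naturality _ _ _ := rfl

/-- Pullback along a morphism with a section is injective. -/
theorem Hom.pull_injective_of_section {X Y : Supermanifold.{u}} {μ : X ⟶ Y} {s : Y ⟶ X}
    (h : s ≫ μ = 𝟙 Y) (V : Opens Y.supp) : Function.Injective (Hom.pull μ V) := by
  have hV : V ≤ Opens.comap (GrHom.base (s ≫ μ)) V := by rw [h]; exact le_rfl
  intro f g hfg
  have key : ∀ f : Y.toGrSpace.sec V, Y.toGrSpace.res hV (Hom.pull s _ (Hom.pull μ V f)) = f :=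
    fun f => (GrHom.pull_congr h.symm V f).symm
  rw [← key f, hfg, key g]

end Supermanifold

namespace VectorField

variable {X Y : Supermanifold.{u}}

@[simp] theorem app_one {j : ℤ} (φ : VectorField X j) (U : Opens X.supp) : φ.app U 1 = 0 := by
  have h := φ.leibniz U (f := 1) 1 SetLike.GradedOne.one_mem
  simpa using h

/-- The Leibniz rule, for a first factor that need not be homogeneous. -/
theorem app_mul (φ : VectorField X 1) (U : Opens X.supp) (f g : X.toGrSpace.sec U) :
    φ.app U (f * g) = φ.app U f * g + X.toGrSpace.parity U f * φ.app U g := by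
  induction f using induction_homogeneous (X.toGrSpace.isInternal U) with
  | add a b h1 h2 => simp only [map_add, add_mul, h1, h2]; abel
  | hom k a ha =>
    rw [φ.leibniz U g ha, X.toGrSpace.parity_of_mem ha, one_mul, smul_mul_assoc]

/-- Even derivations satisfy the Leibniz rule without signs. -/
theorem app_mul_two (φ : VectorField X 2) (U : Opens X.supp) (f g : X.toGrSpace.sec U) :
    φ.app U (f * g) = φ.app U f * g + f * φ.app U g := by
  induction f using induction_homogeneous (X.toGrSpace.isInternal U) with
  | add a b h1 h2 => simp only [map_add, add_mul, h1, h2]; abel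
  | hom k a ha =>
    rw [φ.leibniz U g ha, zpow_mul]
    norm_num

/-- The algebra homomorphism `f ↦ f + ε φ(f)` given by a vector field `φ` of degree `1`. -/
def flowHom (φ : VectorField X 1) (V : Opens X.supp) :
    X.toGrSpace.sec V →ₐ[ℝ] EpsAlg (X.toGrSpace.parity V) :=
  EpsAlg.homMk (AlgHom.id ℝ _) (φ.app V) (φ.app_one V) (φ.app_mul V)

/-- The morphism `X[ε] → X`, `f ↦ f + ε φ(f)`, given by a vector field `φ` of degree `1`:
its flow for the odd time `ε`. -/
def flow (φ : VectorField X 1) : Supermanifold.epsFunctor.obj X ⟶ X where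
  base := ContinuousMap.id _
  pull := fun V : Opens X.supp => φ.flowHom V
  pull_mem V k f hf := ⟨hf, by rw [add_comm]; exact φ.app_mem V hf⟩
  pull_res h f := EpsAlg.ext rfl (φ.app_res h f)

theorem epsZero_flow (φ : VectorField X 1) :
    Supermanifold.epsZero.app X ≫ φ.flow = 𝟙 X := rfl

/-- Every deformation of the identity is given by a vector field. -/
theorem exists_flow_eq (F : Supermanifold.epsFunctor.obj X ⟶ X)
    (hF : Supermanifold.epsZero.app X ≫ F = 𝟙 X) : ∃ φ : VectorField X 1, φ.flow = F := by
  obtain ⟨b, pull, pull_mem, pull_res⟩ := F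
  obtain rfl : b = ContinuousMap.id _ := congrArg GrHom.base hF
  -- `pull`, with the identifications of `V` and its preimage under the identity made
  let P : ∀ V : Opens X.supp, X.toGrSpace.sec V →ₐ[ℝ] EpsAlg (X.toGrSpace.parity V) := pull
  have hfst : ∀ (V : Opens X.supp) (f : X.toGrSpace.sec V), (P V f).1 = f := by
    intro V f
    exact (GrHom.pull_congr hF V f).trans (X.toGrSpace.res_refl _)
  refine ⟨{ app := fun V =>
              { toFun := fun f => (P V f).2
                map_add' := fun f g => congrArg EpsAlg.snd (map_add (P V) f g)
                map_smul' := fun r f => congrArg EpsAlg.snd (map_smul (P V) r f) }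
            app_mem := fun V k f hf => by rw [add_comm]; exact (pull_mem V hf).2
            leibniz := fun V k f g hf => by
              have h : (P V (f * g)).2 = (P V f * P V g).2 :=
                congrArg EpsAlg.snd (map_mul (P V) f g)
              have h' : (P V f * P V g).2 = (P V f).2 * (P V g).1 +
                X.toGrSpace.parity V (P V f).1 * (P V g).2 := rfl
              rw [h', hfst, hfst, X.toGrSpace.parity_of_mem hf] at h
              refine h.trans ?_
              rw [one_mul, smul_mul_assoc]
              rfl
            app_res := fun {U V} h f => by
              have h' : P V (X.toGrSpace.res h f) = X.toGrSpace.eps.res h (P U f) := pull_res h f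
              exact congrArg EpsAlg.snd h' }, ?_⟩
  refine GrHom.ext_of_res rfl fun V f => ?_
  refine (GrSpace.res_refl _ _).trans ?_
  exact EpsAlg.ext (hfst V f).symm rfl

/-- Relatedness of vector fields is compatibility of their flows. -/
theorem related_iff {μ : X ⟶ Y} {φ : VectorField X 1} {ψ : VectorField Y 1} :
    Related μ φ ψ ↔ Supermanifold.epsFunctor.map μ ≫ ψ.flow = φ.flow ≫ μ := by
  constructor
  · intro h
    refine GrHom.ext_of_res rfl fun V f => ?_
    refine (GrSpace.res_refl _ _).trans ?_
    exact EpsAlg.ext rfl (h V f)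
  · intro h V f
    have h : EpsAlg.map (GrHom.pull μ V) (GrHom.pull_parity μ V) (ψ.flowHom V f) =
        φ.flowHom _ (GrHom.pull μ V f) :=
      (GrHom.pull_congr h V f).trans (GrSpace.res_refl _ _)
    exact congrArg EpsAlg.snd h

instance (j : ℤ) : Zero (VectorField X j) where
  zero :=
    { app := fun _ => 0
      app_mem := fun _ _ _ _ => zero_mem _
      leibniz := fun _ _ _ _ _ => by simp
      app_res := fun _ _ => by simp }

theorem related_zero (μ : X ⟶ Y) (j : ℤ) :
    Related μ (0 : VectorField X j) (0 : VectorField Y j) :=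
  fun V _ => map_zero (Supermanifold.Hom.pull μ V)

/-- The square of a vector field of degree `1`. It is a derivation because the two mixed terms of
`φ(φ(f g))` have opposite signs. -/
def sq (φ : VectorField X 1) : VectorField X 2 where
  app U := φ.app U ∘ₗ φ.app U
  app_mem U k f hf := by
    have := φ.app_mem U (φ.app_mem U hf)
    rwa [← add_assoc] at this
  leibniz U k f g hf := by
    simp only [LinearMap.comp_apply]
    rw [φ.leibniz U g hf, map_add, map_smul, φ.leibniz U g (φ.app_mem U hf), φ.leibniz U _ hf,
      smul_add, smul_smul, one_mul, one_mul, zpow_add₀ (by norm_num), zpow_mul, ← mul_zpow]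
    norm_num
  app_res h f := by
    simp only [LinearMap.comp_apply, φ.app_res]

/-- As `φ` is odd, `[φ, φ] = 2 φ²`. -/
theorem isHomological_iff {φ : VectorField X 1} : φ.IsHomological ↔ φ.sq = 0 := by
  have h : ∀ U, bracket φ φ U = (2 : ℝ) • φ.sq.app U := by
    intro U
    simp only [bracket, sq]
    rw [mul_one, zpow_one, two_smul]
    module
  constructor
  · intro hφ
    ext U f
    have := hφ U
    rw [h, smul_eq_zero_iff_right two_ne_zero] at this
    exact LinearMap.congr_fun this f
  · intro hφ U
    rw [h, hφ]
    exact smul_zero _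

theorem Related.sq {μ : X ⟶ Y} {φ : VectorField X 1} {ψ : VectorField Y 1} (h : Related μ φ ψ) :
    Related μ φ.sq ψ.sq := fun V f => by
  change Supermanifold.Hom.pull μ V (ψ.app V (ψ.app V f)) = φ.app _ (φ.app _ _)
  rw [h, h]

/-- The algebra homomorphism `f ↦ f + ε₂ ε₁ φ(f)` given by a vector field `φ` of degree `2`. -/
def flow₂Hom (φ : VectorField X 2) (V : Opens X.supp) :
    X.toGrSpace.sec V →ₐ[ℝ] EpsAlg (X.toGrSpace.eps.parity V) :=
  let i : X.toGrSpace.sec V →ₐ[ℝ] EpsAlg (X.toGrSpace.parity V) :=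
    EpsAlg.homMk (AlgHom.id ℝ _) 0 rfl (by simp)
  let D : X.toGrSpace.sec V →ₗ[ℝ] EpsAlg (X.toGrSpace.parity V) :=
    { toFun := fun f => ⟨0, φ.app V f⟩
      map_add' := fun f g => EpsAlg.ext (by simp) (by simp)
      map_smul' := fun r f => EpsAlg.ext (by simp) (by simp) }
  EpsAlg.homMk (σ := X.toGrSpace.eps.parity V) i D (EpsAlg.ext rfl (φ.app_one V)) (by
    intro f g
    induction f using induction_homogeneous (X.toGrSpace.isInternal V) with
    | add a b h1 h2 => simp only [map_add, add_mul, h1, h2]; abel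
    | hom k f hf =>
      have hi : i f ∈ X.toGrSpace.eps.gr V k := ⟨hf, zero_mem _⟩
      rw [X.toGrSpace.eps.parity_of_mem hi]
      refine EpsAlg.ext ?_ ?_
      · change (0 : X.toGrSpace.sec V) = 0 * g + ((-1 : ℝ) ^ k • f) * 0
        simp
      · change φ.app V (f * g) = (φ.app V f * g + X.toGrSpace.parity V 0 * 0) +
          (((-1 : ℝ) ^ k • (0 : X.toGrSpace.sec V)) * 0 +
            X.toGrSpace.parity V ((-1 : ℝ) ^ k • f) * φ.app V g)
        rw [φ.app_mul_two, map_smul, X.toGrSpace.parity_of_mem hf, smul_smul,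
          ← mul_zpow]
        simp)

/-- The morphism `X[ε₁][ε₂] → X`, `f ↦ f + ε₂ ε₁ φ(f)`, given by a vector field `φ` of
degree `2`. -/
def flow₂ (φ : VectorField X 2) :
    Supermanifold.epsFunctor.obj (Supermanifold.epsFunctor.obj X) ⟶ X where
  base := ContinuousMap.id _
  pull := fun V : Opens X.supp => φ.flow₂Hom V
  pull_mem V k f hf := ⟨⟨hf, zero_mem _⟩, ⟨zero_mem _, by
    have := φ.app_mem V hf
    rwa [show (2 : ℤ) + k = k + 1 + 1 by ring] at this⟩⟩
  pull_res h f := EpsAlg.ext (EpsAlg.ext rfl (map_zero (X.toGrSpace.res h)).symm)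
    (EpsAlg.ext (map_zero (X.toGrSpace.res h)).symm (φ.app_res h f))

theorem flow₂_injective : Function.Injective (flow₂ : VectorField X 2 → _) := by
  intro φ φ' h
  ext U f
  have h : φ.flow₂Hom U f = φ'.flow₂Hom U f :=
    (GrHom.pull_congr h U f).trans (GrSpace.res_refl _ _)
  exact congrArg EpsAlg.snd (congrArg EpsAlg.snd h)

/-- Relatedness of vector fields of degree `2` is compatibility of the morphisms `flow₂`. -/
theorem Related.flow₂ {μ : X ⟶ Y} {φ : VectorField X 2} {ψ : VectorField Y 2}
    (h : Related μ φ ψ) :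
    Supermanifold.epsFunctor.map (Supermanifold.epsFunctor.map μ) ≫ ψ.flow₂ = φ.flow₂ ≫ μ := by
  refine GrHom.ext_of_res rfl fun V f => ?_
  refine (GrSpace.res_refl _ _).trans ?_
  exact EpsAlg.ext (EpsAlg.ext rfl (map_zero (GrHom.pull μ V)))
    (EpsAlg.ext (map_zero (GrHom.pull μ V)) (h V f))

end VectorField

open Supermanifold

/-! ### Lifting vector fields along jointly monic families -/

/-- A family of morphisms is jointly monic if morphisms into its source are determined by their
components. -/
def JointlyMonic {ι : Type*} {X : Supermanifold.{u}} {Y : ι → Supermanifold.{u}}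
    (π : ∀ i, X ⟶ Y i) : Prop :=
  ∀ ⦃T : Supermanifold.{u}⦄ (a b : T ⟶ X), (∀ i, a ≫ π i = b ≫ π i) → a = b

namespace VectorField

variable {X Y Z : Supermanifold.{u}}

theorem Related.comp {j : ℤ} {μ : X ⟶ Y} {ν : Y ⟶ Z} {φ : VectorField X j} {ψ : VectorField Y j}
    {χ : VectorField Z j} (h : Related μ φ ψ) (h' : Related ν ψ χ) : Related (μ ≫ ν) φ χ := by
  intro V f
  change Hom.pull μ _ (Hom.pull ν V _) = φ.app _ (Hom.pull μ _ (Hom.pull ν V f))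
  rw [h', h]

theorem eq_of_related_id {φ φ' : VectorField X 1} (h : Related (𝟙 X) φ φ') : φ = φ' :=
  VectorField.ext (funext fun U => LinearMap.ext fun f => (h U f).symm)

variable {ι : Type*} {W : ι → Supermanifold.{u}} {π : ∀ i, Y ⟶ W i} {ψ : ∀ i, VectorField (W i) 1}

/-- Relatedness under `μ` may be checked after composition with a jointly monic family. -/
theorem related_of_jointlyMonic (hπ : JointlyMonic π) {μ : X ⟶ Y} {φ : VectorField X 1}
    {χ : VectorField Y 1} (h : ∀ i, Related (π i) χ (ψ i)) (h' : ∀ i, Related (μ ≫ π i) φ (ψ i)) :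
    Related μ φ χ := by
  rw [related_iff]
  refine hπ _ _ fun i => ?_
  rw [Category.assoc, Category.assoc, ← related_iff.1 (h' i), ← related_iff.1 (h i),
    Functor.map_comp, Category.assoc]

theorem eq_of_jointlyMonic (hπ : JointlyMonic π) {φ χ : VectorField Y 1}
    (h : ∀ i, Related (π i) φ (ψ i)) (h' : ∀ i, Related (π i) χ (ψ i)) : φ = χ :=
  eq_of_related_id (related_of_jointlyMonic hπ h' fun i => by rw [Category.id_comp]; exact h i)

/-- A vector field is homological if its components under a jointly monic family are: its square
then has components `0`, as the zero vector field has. -/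
theorem isHomological_of_jointlyMonic (hπ : JointlyMonic π) {φ : VectorField Y 1}
    (h : ∀ i, Related (π i) φ (ψ i)) (hψ : ∀ i, (ψ i).IsHomological) : φ.IsHomological := by
  rw [isHomological_iff]
  refine flow₂_injective (hπ _ _ fun i => ?_)
  have h1 := (h i).sq
  rw [isHomological_iff.1 (hψ i)] at h1
  rw [← h1.flow₂, ← (related_zero (π i) 2).flow₂]

theorem isHomological_of_section {μ : X ⟶ Y} {s : Y ⟶ X} (hs : s ≫ μ = 𝟙 Y)
    {φ : VectorField X 1} {χ : VectorField Y 1} (h : Related μ φ χ) (hφ : φ.IsHomological) :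
    χ.IsHomological := by
  rw [isHomological_iff] at hφ ⊢
  have h1 := h.sq
  rw [hφ] at h1
  refine VectorField.ext (funext fun U => LinearMap.ext fun f => ?_)
  refine Hom.pull_injective_of_section hs U ((h1 U f).trans ?_)
  exact (map_zero (Hom.pull μ U)).symm

theorem eq_of_section {μ : X ⟶ Y} {s : Y ⟶ X} (hs : s ≫ μ = 𝟙 Y) {φ : VectorField X 1}
    {χ χ' : VectorField Y 1} (h : Related μ φ χ) (h' : Related μ φ χ') : χ = χ' :=
  VectorField.ext (funext fun U => LinearMap.ext fun f =>
    Hom.pull_injective_of_section hs U ((h U f).trans (h' U f).symm))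

end VectorField

namespace Supergroupoid

open ZGraded.VectorField

variable {𝒢 : Supergroupoid.{u}}

/-! ### Multiplicative vector fields on the nerve -/

theorem jointlyMonic_p₁_p₂ (𝒢 : Supergroupoid.{u}) :
    JointlyMonic (fun b : Bool => cond b 𝒢.p₁ 𝒢.p₂) :=
  fun _ _ _ h => 𝒢.isPullback.hom_ext (h true) (h false)

theorem IsTuples.jointlyMonic {n : ℕ} {X : Supermanifold.{u}} {π : Fin (n + 1) → (X ⟶ 𝒢.arr)}
    (h : 𝒢.IsTuples X π) : JointlyMonic π := by
  intro T a b hab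
  have hb : 𝒢.Compatible fun i => b ≫ π i := fun i => by
    rw [Category.assoc, Category.assoc, h.1 i]
  exact (h.2 T _ hb).unique hab fun _ => rfl

/-- A multiplicative vector field projects to the same vector field under source and target:
`p₁^*(ψ s^*f) = p₂^*(ψ t^*f)` on pairs of composable arrows, and this is restricted to the pairs
with one identity arrow. -/
theorem IsMultiplicative.exists_related {ψ : VectorField 𝒢.arr 1} (h : 𝒢.IsMultiplicative ψ) :
    ∃ ψ₀ : VectorField 𝒢.obj 1, Related 𝒢.src ψ ψ₀ ∧ Related 𝒢.tgt ψ ψ₀ := by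
  obtain ⟨ψ₂, h1, h2, -⟩ := h
  rw [related_iff] at h1 h2
  have key : ∀ x : 𝒢.arr ⟶ 𝒢.arr₂, epsFunctor.map (x ≫ 𝒢.p₁) ≫ ψ.flow ≫ 𝒢.src =
      epsFunctor.map (x ≫ 𝒢.p₂) ≫ ψ.flow ≫ 𝒢.tgt := by
    intro x
    rw [Functor.map_comp, Functor.map_comp, Category.assoc, Category.assoc, reassoc_of% h1,
      reassoc_of% h2, 𝒢.isPullback.w]
  -- the pairs `(g, 1)` and `(1, g)`
  have e1 : 𝟙 𝒢.arr ≫ 𝒢.src = (𝒢.src ≫ 𝒢.one) ≫ 𝒢.tgt := by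
    rw [Category.assoc, 𝒢.one_tgt, Category.comp_id, Category.id_comp]
  have e2 : (𝒢.tgt ≫ 𝒢.one) ≫ 𝒢.src = 𝟙 𝒢.arr ≫ 𝒢.tgt := by
    rw [Category.assoc, 𝒢.one_src, Category.comp_id, Category.id_comp]
  have k1 := key (𝒢.isPullback.lift _ _ e1)
  have k2 := key (𝒢.isPullback.lift _ _ e2)
  rw [IsPullback.lift_fst, IsPullback.lift_snd, CategoryTheory.Functor.map_id, Category.id_comp,
    Functor.map_comp, Category.assoc] at k1 k2
  -- `ψ₀ = 1^* ψ t^*`, the restriction of `ψ` to the identity arrows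
  obtain ⟨ψ₀, hψ₀⟩ := exists_flow_eq (epsFunctor.map 𝒢.one ≫ ψ.flow ≫ 𝒢.tgt) (by
    rw [← Category.assoc, ← epsZero.naturality, Category.assoc, ← Category.assoc (epsZero.app _),
      epsZero_flow]
    exact 𝒢.one_tgt)
  have hs : Related 𝒢.src ψ ψ₀ := by
    rw [related_iff, hψ₀, k1]
  refine ⟨ψ₀, hs, ?_⟩
  rw [related_iff] at hs ⊢
  have e : epsFunctor.map 𝒢.one ≫ epsFunctor.map 𝒢.src = 𝟙 _ := by
    rw [← Functor.map_comp, 𝒢.one_src, CategoryTheory.Functor.map_id]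
  rw [← k2, ← hs, reassoc_of% e]

/-- A vector field on `𝒢` with a common projection under source and target lifts to the spaces of
compatible tuples: its flow, applied to each component, gives compatible tuples again. -/
theorem IsTuples.exists_related {n : ℕ} {X : Supermanifold.{u}} {π : Fin (n + 1) → (X ⟶ 𝒢.arr)}
    (h : 𝒢.IsTuples X π) {ψ : VectorField 𝒢.arr 1} {ψ₀ : VectorField 𝒢.obj 1}
    (hs : Related 𝒢.src ψ ψ₀) (ht : Related 𝒢.tgt ψ ψ₀) :
    ∃ φ : VectorField X 1, ∀ i, Related (π i) φ ψ := by
  rw [related_iff] at hs ht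
  obtain ⟨F, hF, -⟩ := h.2 _ (fun i => epsFunctor.map (π i) ≫ ψ.flow) fun i => by
    rw [Category.assoc, Category.assoc, ← hs, ← ht, ← Functor.map_comp_assoc,
      ← Functor.map_comp_assoc, h.1 i]
  obtain ⟨φ, rfl⟩ := exists_flow_eq F (h.jointlyMonic _ _ fun i => by
    rw [Category.assoc, hF, ← Category.assoc, ← epsZero.naturality, Category.assoc, epsZero_flow]
    exact (Category.comp_id _).trans (Category.id_comp _).symm)
  exact ⟨φ, fun i => related_iff.2 (hF i).symm⟩

namespace Nerve

variable (N : 𝒢.Nerve)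

theorem face_entry (q : ℕ) (i : Fin (q + 3)) (j : Fin (q + 1)) :
    N.face (q + 1) i ≫ N.entry q j = N.faceEntry q i j :=
  ((N.isTuples_level q).2 _ (N.faceEntry q i) (N.faceEntry_compatible q i)).choose_spec.1 j

theorem related_entryMul {ψ : VectorField 𝒢.arr 1} (h : 𝒢.IsMultiplicative ψ) {q : ℕ}
    {φ : VectorField (N.level (q + 2)) 1} (hφ : ∀ i, Related (N.entry (q + 1) i) φ ψ)
    (j : Fin (q + 1)) : Related (N.entryMul q j) φ ψ := by
  obtain ⟨ψ₂, h1, h2, hm⟩ := h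
  refine Related.comp (related_of_jointlyMonic 𝒢.jointlyMonic_p₁_p₂ (ψ := fun _ => ψ) (χ := ψ₂)
    ?_ ?_) hm
  · rintro (_ | _)
    exacts [h2, h1]
  · rintro (_ | _)
    · exact (𝒢.isPullback.lift_snd _ _ _).symm ▸ hφ _
    · exact (𝒢.isPullback.lift_fst _ _ _).symm ▸ hφ _

theorem related_face {ψ : VectorField 𝒢.arr 1} (h : 𝒢.IsMultiplicative ψ) {q : ℕ}
    {φ : VectorField (N.level (q + 2)) 1} (hφ : ∀ i, Related (N.entry (q + 1) i) φ ψ)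
    {χ : VectorField (N.level (q + 1)) 1} (hχ : ∀ i, Related (N.entry q i) χ ψ)
    (i : Fin (q + 3)) : Related (N.face (q + 1) i) φ χ := by
  refine related_of_jointlyMonic (N.isTuples_level q).jointlyMonic hχ fun j => ?_
  rw [N.face_entry]
  unfold faceEntry
  split_ifs
  exacts [hφ _, N.related_entryMul h hφ _, hφ _]

/-- A family of vector fields on the nerve that is compatible with the faces is related under all
components to its member on the space of arrows. -/
theorem related_entry_of_related_face {Ψ : ∀ q : ℕ, VectorField (N.level q) 1}
    (h : ∀ (q : ℕ) (i : Fin (q + 2)), Related (N.face q i) (Ψ (q + 1)) (Ψ q)) :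
    ∀ (q : ℕ) (j : Fin (q + 1)), Related (N.entry q j) (Ψ (q + 1)) (Ψ 1)
  | 0, _ => fun _ _ => rfl
  | q + 1, j => by
    have key : ∀ (i : Fin (q + 3)) (k : Fin (q + 1)),
        Related (N.faceEntry q i k) (Ψ (q + 2)) (Ψ 1) := fun i k => by
      rw [← N.face_entry]
      exact (h (q + 1) i).comp (related_entry_of_related_face h q k)
    -- the first component is seen by the last face, the others by the zeroth face
    induction j using Fin.cases with
    | zero =>
      have := key (Fin.last _) 0
      rwa [faceEntry, if_pos (by simp)] at this
    | succ k =>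
      have := key 0 k
      rwa [faceEntry, if_neg (by simp), if_neg (by simp)] at this

/-! ### The simplicial identities -/

open Classical in
/-- The product of two composable `T`-valued points of `𝒢`; the value for other pairs is
irrelevant. -/
def mulPoint {T : Supermanifold.{u}} (a b : T ⟶ 𝒢.arr) : T ⟶ 𝒢.arr :=
  if h : a ≫ 𝒢.src = b ≫ 𝒢.tgt then 𝒢.isPullback.lift a b h ≫ 𝒢.mul else a

theorem mulPoint_eq {T : Supermanifold.{u}} {a b : T ⟶ 𝒢.arr} (h : a ≫ 𝒢.src = b ≫ 𝒢.tgt) :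
    mulPoint a b = 𝒢.isPullback.lift a b h ≫ 𝒢.mul := dif_pos h

theorem mulPoint_src {T : Supermanifold.{u}} {a b : T ⟶ 𝒢.arr} (h : a ≫ 𝒢.src = b ≫ 𝒢.tgt) :
    mulPoint a b ≫ 𝒢.src = b ≫ 𝒢.src := by
  rw [mulPoint_eq h, Category.assoc, 𝒢.mul_src, 𝒢.isPullback.lift_snd_assoc]

theorem mulPoint_tgt {T : Supermanifold.{u}} {a b : T ⟶ 𝒢.arr} (h : a ≫ 𝒢.src = b ≫ 𝒢.tgt) :
    mulPoint a b ≫ 𝒢.tgt = a ≫ 𝒢.tgt := by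
  rw [mulPoint_eq h, Category.assoc, 𝒢.mul_tgt, 𝒢.isPullback.lift_fst_assoc]

theorem comp_mulPoint {S T : Supermanifold.{u}} (x : S ⟶ T) {a b : T ⟶ 𝒢.arr}
    (h : a ≫ 𝒢.src = b ≫ 𝒢.tgt) : x ≫ mulPoint a b = mulPoint (x ≫ a) (x ≫ b) := by
  have h' : (x ≫ a) ≫ 𝒢.src = (x ≫ b) ≫ 𝒢.tgt := by rw [Category.assoc, h, Category.assoc]
  rw [mulPoint_eq h, mulPoint_eq h', ← Category.assoc]
  congr 1
  refine 𝒢.isPullback.hom_ext ?_ ?_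
  · rw [Category.assoc, IsPullback.lift_fst, IsPullback.lift_fst]
  · rw [Category.assoc, IsPullback.lift_snd, IsPullback.lift_snd]

theorem mulPoint_assoc {T : Supermanifold.{u}} {a b c : T ⟶ 𝒢.arr}
    (hab : a ≫ 𝒢.src = b ≫ 𝒢.tgt) (hbc : b ≫ 𝒢.src = c ≫ 𝒢.tgt) :
    mulPoint (mulPoint a b) c = mulPoint a (mulPoint b c) := by
  rw [mulPoint_eq (a := mulPoint a b) (by rw [mulPoint_src hab, hbc]),
    mulPoint_eq (b := mulPoint b c) (by rw [mulPoint_tgt hbc, hab])]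
  simp only [mulPoint_eq hab, mulPoint_eq hbc]
  exact 𝒢.mul_assoc a b c hab hbc

/-- The component `g_{n+1}` of a point of `𝒢^{(q+1)}`, for `n ≤ q`. (Indices `n > q` are reduced
modulo `q + 1`.) -/
def ent (q n : ℕ) : N.level (q + 1) ⟶ 𝒢.arr := N.entry q (Fin.ofNat (q + 1) n)

theorem ent_val {q : ℕ} (j : Fin (q + 1)) : N.ent q j = N.entry q j := by
  rw [ent, Fin.ofNat_val_eq_self]

theorem ent_src {q n : ℕ} (hn : n < q) : N.ent q n ≫ 𝒢.src = N.ent q (n + 1) ≫ 𝒢.tgt := by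
  have := (N.isTuples_level q).1 ⟨n, hn⟩
  rwa [← ent_val, ← ent_val] at this

theorem face_ent {q : ℕ} (i : Fin (q + 3)) {n : ℕ} (hn : n ≤ q) :
    N.face (q + 1) i ≫ N.ent q n =
      if n + 1 < i then N.ent (q + 1) n
      else if n + 1 = i then mulPoint (N.ent (q + 1) n) (N.ent (q + 1) (n + 1))
      else N.ent (q + 1) (n + 1) := by
  obtain ⟨j, rfl⟩ : ∃ j : Fin (q + 1), (j : ℕ) = n := ⟨⟨n, by omega⟩, rfl⟩
  rw [ent_val, face_entry, faceEntry, ← ent_val, ← ent_val, entryMul]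
  simp only [← ent_val, Fin.val_castSucc, Fin.val_succ]
  rw [mulPoint_eq (N.ent_src (by omega))]

theorem face_ent_of_lt {q : ℕ} {i : Fin (q + 3)} {n : ℕ} (hn : n ≤ q) (h : n + 1 < i) :
    N.face (q + 1) i ≫ N.ent q n = N.ent (q + 1) n := by
  rw [face_ent N i hn, if_pos h]

theorem face_ent_of_eq {q : ℕ} {i : Fin (q + 3)} {n : ℕ} (hn : n ≤ q) (h : n + 1 = i) :
    N.face (q + 1) i ≫ N.ent q n = mulPoint (N.ent (q + 1) n) (N.ent (q + 1) (n + 1)) := by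
  rw [face_ent N i hn, if_neg (by omega), if_pos h]

theorem face_ent_of_gt {q : ℕ} {i : Fin (q + 3)} {n : ℕ} (hn : n ≤ q) (h : (i : ℕ) < n + 1) :
    N.face (q + 1) i ≫ N.ent q n = N.ent (q + 1) (n + 1) := by
  rw [face_ent N i hn, if_neg (by omega), if_neg (by omega)]

theorem face_one (i : Fin 3) : N.face 1 i = N.faceEntry 0 i 0 :=
  (Category.comp_id _).symm.trans (N.face_entry 0 i 0)

theorem face_one_zero : N.face 1 0 = 𝒢.p₂ := N.face_one 0

theorem face_one_one : N.face 1 1 = 𝒢.mul := by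
  rw [face_one]
  refine Eq.trans ?_ (Category.id_comp 𝒢.mul)
  change 𝒢.isPullback.lift 𝒢.p₁ 𝒢.p₂ _ ≫ 𝒢.mul = 𝟙 𝒢.arr₂ ≫ 𝒢.mul
  congr 1
  refine 𝒢.isPullback.hom_ext ?_ ?_
  · exact (𝒢.isPullback.lift_fst _ _ _).trans (Category.id_comp _).symm
  · exact (𝒢.isPullback.lift_snd _ _ _).trans (Category.id_comp _).symm

theorem face_one_two : N.face 1 2 = 𝒢.p₁ := N.face_one 2

/-- The simplicial identities. Associativity enters when two consecutive products are formed. -/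
theorem face_comp_face : ∀ (q : ℕ) {i j : Fin (q + 2)}, i ≤ j →
    N.face (q + 1) j.succ ≫ N.face q i = N.face (q + 1) i.castSucc ≫ N.face q j
  | 0, i, j, hij => by
    fin_cases i <;> fin_cases j
    · change N.face 1 1 ≫ 𝒢.src = N.face 1 0 ≫ 𝒢.src
      rw [face_one_one, face_one_zero]
      exact 𝒢.mul_src
    · change N.face 1 2 ≫ 𝒢.src = N.face 1 0 ≫ 𝒢.tgt
      rw [face_one_two, face_one_zero]
      exact 𝒢.isPullback.w
    · exact absurd hij (by decide)
    · change N.face 1 2 ≫ 𝒢.tgt = N.face 1 1 ≫ 𝒢.tgt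
      rw [face_one_two, face_one_one]
      exact 𝒢.mul_tgt.symm
  | q + 1, i, j, hij => by
    refine (N.isTuples_level q).jointlyMonic _ _ fun k => ?_
    rw [← ent_val]
    obtain ⟨n, hn⟩ := k
    have hij : (i : ℕ) ≤ j := hij
    have hjs : (j.succ : ℕ) = j + 1 := Fin.val_succ j
    have hic : (i.castSucc : ℕ) = i := Fin.val_castSucc i
    have c : ∀ m, m ≤ q + 1 → N.ent (q + 2) m ≫ 𝒢.src = N.ent (q + 2) (m + 1) ≫ 𝒢.tgt :=
      fun m hm => N.ent_src (by omega)
    have c' : N.ent (q + 1) n ≫ 𝒢.src = N.ent (q + 1) (n + 1) ≫ 𝒢.tgt := N.ent_src (by omega)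
    simp only [Category.assoc]
    rcases lt_trichotomy (n + 1) (i : ℕ) with h | h | h
    · rw [N.face_ent_of_lt (by omega) h, N.face_ent_of_lt (i := j) (by omega) (by omega),
        N.face_ent_of_lt (by omega) (by omega), N.face_ent_of_lt (by omega) (by omega)]
    · rw [N.face_ent_of_eq (by omega) h, comp_mulPoint _ c',
        N.face_ent_of_lt (i := j.succ) (n := n) (by omega) (by omega)]
      rcases hij.lt_or_eq with h' | h'
      · rw [N.face_ent_of_lt (i := j.succ) (n := n + 1) (by omega) (by omega),
          N.face_ent_of_lt (i := j) (by omega) (by omega),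
          N.face_ent_of_eq (i := i.castSucc) (by omega) (by omega)]
      · rw [N.face_ent_of_eq (i := j.succ) (n := n + 1) (by omega) (by omega),
          N.face_ent_of_eq (i := j) (by omega) (by omega), comp_mulPoint _ c',
          N.face_ent_of_eq (i := i.castSucc) (by omega) (by omega),
          N.face_ent_of_gt (i := i.castSucc) (by omega) (by omega),
          mulPoint_assoc (c n (by omega)) (c (n + 1) (by omega))]
    · rw [N.face_ent_of_gt (by omega) h]
      rcases lt_trichotomy (n + 1) (j : ℕ) with h' | h' | h'
      · rw [N.face_ent_of_lt (by omega) (by omega), N.face_ent_of_lt (by omega) h',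
          N.face_ent_of_gt (by omega) (by omega)]
      · rw [N.face_ent_of_eq (by omega) (by omega), N.face_ent_of_eq (by omega) h',
          comp_mulPoint _ c', N.face_ent_of_gt (by omega) (by omega),
          N.face_ent_of_gt (by omega) (by omega)]
      · rw [N.face_ent_of_gt (by omega) (by omega), N.face_ent_of_gt (by omega) h',
          N.face_ent_of_gt (by omega) (by omega)]

end Nerve

end Supergroupoid

/-! ### The double complex -/

/-- An alternating double sum of terms that satisfy the simplicial identities vanishes. -/
theorem sum_neg_one_pow_simplicial {M : Type*} [AddCommGroup M] [Module ℝ M] {n : ℕ}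
    (f : Fin (n + 2) → Fin (n + 3) → M) (hf : ∀ i j : Fin (n + 2), i ≤ j →
      f i j.succ = f j i.castSucc) :
    ∑ i : Fin (n + 2), ∑ j : Fin (n + 3), ((-1 : ℝ) ^ (j : ℕ) * (-1) ^ (i : ℕ)) • f i j = 0 := by
  rw [← Fintype.sum_prod_type']
  -- the terms with `j ≤ i` cancel against those with `j > i`, by `(i, j) ↦ (j, i + 1)`
  let S : Finset (Fin (n + 2) × Fin (n + 3)) := {x | (x.2 : ℕ) ≤ (x.1 : ℕ)}
  rw [← Finset.sum_add_sum_compl S, ← eq_neg_iff_add_eq_zero, ← Finset.sum_neg_distrib]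
  have hS : ∀ x : Fin (n + 2) × Fin (n + 3), x ∈ S ↔ (x.2 : ℕ) ≤ x.1 := fun x => by simp [S]
  refine Finset.sum_bij' (fun x hx => (x.2.castLT (((hS x).1 hx).trans_lt x.1.2), x.1.succ))
    (fun x hx => (x.2.pred (by
      rw [Finset.mem_compl, hS] at hx
      exact fun h => hx (by rw [h]; exact Nat.zero_le _)), x.1.castSucc)) ?_ ?_ ?_ ?_ ?_
  · intro x hx
    rw [hS] at hx
    rw [Finset.mem_compl, hS]
    simp only [Fin.val_succ, Fin.val_castLT]
    omega
  · intro x hx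
    rw [Finset.mem_compl, hS] at hx
    rw [hS]
    simp only [Fin.val_castSucc, Fin.val_pred]
    omega
  · intro x hx
    simp
  · intro x hx
    simp
  · intro x hx
    have h := hf (x.2.castLT (((hS x).1 hx).trans_lt x.1.2)) x.1 ((hS x).1 hx)
    rw [Fin.castSucc_castLT] at h
    rw [h, ← neg_smul]
    congr 1
    simp only [Fin.val_succ, Fin.val_castLT]
    ring

namespace Supergroupoid.Nerve

variable {𝒢 : Supergroupoid.{u}} (N : 𝒢.Nerve)

theorem coboundary_apply (q : ℕ) (f : (N.level q).Fun) : N.coboundary q f =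
    ∑ i : Fin (q + 2), (-1 : ℝ) ^ (i : ℕ) • Hom.globalPull (N.face q i) f := by
  simp [coboundary]

theorem coboundary_coboundary (q : ℕ) (f : (N.level q).Fun) :
    N.coboundary (q + 1) (N.coboundary q f) = 0 := by
  have h := sum_neg_one_pow_simplicial
    (fun i j => (Hom.globalPull (N.face (q + 1) j ≫ N.face q i) f : (N.level (q + 2)).Fun))
    (fun i j hij => by rw [N.face_comp_face q hij])
  rw [Finset.sum_comm] at h
  rw [coboundary_apply, coboundary_apply]
  refine Eq.trans (Finset.sum_congr rfl fun j _ => ?_) h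
  rw [map_sum, Finset.smul_sum]
  refine Finset.sum_congr rfl fun i _ => ?_
  rw [map_smul, smul_smul]
  rfl

theorem app_coboundary {Ψ : ∀ q : ℕ, VectorField (N.level q) 1} {q : ℕ}
    (h : ∀ i : Fin (q + 2), VectorField.Related (N.face q i) (Ψ (q + 1)) (Ψ q))
    (f : (N.level q).Fun) :
    (Ψ (q + 1)).app ⊤ (N.coboundary q f) = N.coboundary q ((Ψ q).app ⊤ f) := by
  rw [coboundary_apply, coboundary_apply, map_sum]
  refine Finset.sum_congr rfl fun i _ => ?_
  rw [map_smul]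
  exact congrArg _ (h i ⊤ f).symm

end Supergroupoid.Nerve

theorem VectorField.IsHomological.app_app {X : Supermanifold.{u}} {φ : VectorField X 1}
    (h : φ.IsHomological) (U : Opens X.supp) (f : X.toGrSpace.sec U) :
    φ.app U (φ.app U f) = 0 := by
  rw [VectorField.isHomological_iff] at h
  exact congrArg (fun χ : VectorField X 2 => χ.app U f) h

section DoubleComplex

variable {C : ℤ → ℕ → Type u} [∀ p q, AddCommGroup (C p q)] [∀ p q, Module ℝ (C p q)]

theorem totalDifferential_lof (d : ∀ p q, C p q →ₗ[ℝ] C (p + 1) q)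
    (δ : ∀ p q, C p q →ₗ[ℝ] C p (q + 1)) (p : ℤ) (q : ℕ) (c : C p q) :
    totalDifferential d δ (DirectSum.lof ℝ (ℤ × ℕ) (fun x => C x.1 x.2) (p, q) c) =
      DirectSum.lof ℝ (ℤ × ℕ) (fun x => C x.1 x.2) (p + 1, q) (d p q c) +
      (-1 : ℝ) ^ p • DirectSum.lof ℝ (ℤ × ℕ) (fun x => C x.1 x.2) (p, q + 1) (δ p q c) := by
  rw [totalDifferential, DirectSum.toModule_lof]
  rfl

/-- The total complex of a double complex. -/
theorem IsDoubleComplex.isTotalDifferential {d : ∀ p q, C p q →ₗ[ℝ] C (p + 1) q}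
    {δ : ∀ p q, C p q →ₗ[ℝ] C p (q + 1)} (h : IsDoubleComplex d δ) :
    IsTotalDifferential (totalDifferential d δ) := by
  refine ⟨fun n => iSup_le ?_, ?_⟩
  · rintro ⟨⟨p, q⟩, hpq⟩ _ ⟨c, rfl⟩
    rw [Submodule.mem_comap, totalDifferential_lof]
    have hpq : p + (q : ℤ) = n := hpq
    refine add_mem ?_ (Submodule.smul_mem _ _ ?_)
    · exact Submodule.mem_iSup_of_mem
        (⟨(p + 1, q), by dsimp only; omega⟩ : {x : ℤ × ℕ // x.1 + x.2 = n + 1}) ⟨_, rfl⟩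
    · exact Submodule.mem_iSup_of_mem
        (⟨(p, q + 1), by push_cast; omega⟩ : {x : ℤ × ℕ // x.1 + x.2 = n + 1}) ⟨_, rfl⟩
  · refine DirectSum.linearMap_ext ℝ fun x => LinearMap.ext fun c => ?_
    obtain ⟨p, q⟩ := x
    simp only [LinearMap.comp_apply, LinearMap.zero_apply]
    rw [totalDifferential_lof, map_add, map_smul, totalDifferential_lof, totalDifferential_lof]
    have h1 : d (p + 1) q (d p q c) = 0 := LinearMap.congr_fun (h.d_comp_d p q) c
    have h2 : δ p (q + 1) (δ p q c) = 0 := LinearMap.congr_fun (h.δ_comp_δ p q) c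
    have h3 : δ (p + 1) q (d p q c) = d p (q + 1) (δ p q c) := LinearMap.congr_fun (h.comm p q) c
    -- the mixed terms have the signs `(-1)^p` and `(-1)^(p+1)`
    rw [h1, h2, h3, map_zero, map_zero, smul_zero, add_zero, zero_add, ← add_smul,
      zpow_add_one₀ (by norm_num)]
    simp

end DoubleComplex

end ZGraded

end

theorem mainTheorem3 (𝒢 : ZGraded.QGroupoid.{u}) (N : 𝒢.Nerve) :
    ∃ Ψ : ∀ q : ℕ, ZGraded.VectorField (N.level q) 1,
      -- `Ψ q = ψ^{(q)}` is the unique lift of `ψ` to the nerve that is related under all face maps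
      (Ψ 1 = 𝒢.ψ ∧ ∀ (q : ℕ) (i : Fin (q + 2)),
        ZGraded.VectorField.Related (N.face q i) (Ψ (q + 1)) (Ψ q)) ∧
      (∀ Ψ' : ∀ q : ℕ, ZGraded.VectorField (N.level q) 1,
        (Ψ' 1 = 𝒢.ψ ∧ ∀ (q : ℕ) (i : Fin (q + 2)),
          ZGraded.VectorField.Related (N.face q i) (Ψ' (q + 1)) (Ψ' q)) → Ψ' = Ψ) ∧
      (∀ q : ℕ, (Ψ q).IsHomological) ∧
      -- `ψ` commutes with the groupoid coboundary
      (∀ (q : ℕ) (f : (N.level q).Fun),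
        (Ψ (q + 1)).app ⊤ (N.coboundary q f) = N.coboundary q ((Ψ q).app ⊤ f)) ∧
      -- `(C^{p,q}, δ, ψ)` is a double complex, with total differential `D = ψ + (-1)^p δ`
      ZGraded.IsDoubleComplex (C := N.Cochain) (fun p q => (Ψ q).act p) N.coboundaryDeg ∧
      ZGraded.IsTotalDifferential
        (ZGraded.totalDifferential (C := N.Cochain) (fun p q => (Ψ q).act p) N.coboundaryDeg) := by
  obtain ⟨ψ₀, hs, ht⟩ := 𝒢.multiplicative.exists_related
  have hex : ∀ q, ∃ φ : ZGraded.VectorField (N.level (q + 1)) 1,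
      ∀ i, ZGraded.VectorField.Related (N.entry q i) φ 𝒢.ψ :=
    fun q => (N.isTuples_level q).exists_related hs ht
  choose Φ hΦ using hex
  have h1 : Φ 0 = 𝒢.ψ := ZGraded.VectorField.eq_of_related_id (hΦ 0 0)
  let Ψ : ∀ q : ℕ, ZGraded.VectorField (N.level q) 1 := fun q => match q with
    | 0 => ψ₀
    | q + 1 => Φ q
  have hface : ∀ (q : ℕ) (i : Fin (q + 2)),
      ZGraded.VectorField.Related (N.face q i) (Ψ (q + 1)) (Ψ q) := by
    rintro (_ | q) i
    · change ZGraded.VectorField.Related (N.face 0 i) (Φ 0) ψ₀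
      rw [h1]
      fin_cases i
      exacts [hs, ht]
    · exact N.related_face 𝒢.multiplicative (hΦ (q + 1)) (hΦ q) i
  have hhom : ∀ q, (Ψ q).IsHomological := by
    rintro (_ | q)
    · exact ZGraded.VectorField.isHomological_of_section 𝒢.one_src hs 𝒢.homological
    · exact ZGraded.VectorField.isHomological_of_jointlyMonic (N.isTuples_level q).jointlyMonic
        (hΦ q) fun _ => 𝒢.homological
  have hcomm : ∀ (q : ℕ) (f : (N.level q).Fun),
      (Ψ (q + 1)).app ⊤ (N.coboundary q f) = N.coboundary q ((Ψ q).app ⊤ f) :=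
    fun q f => N.app_coboundary (hface q) f
  have hdouble :
      ZGraded.IsDoubleComplex (C := N.Cochain) (fun p q => (Ψ q).act p) N.coboundaryDeg :=
    { d_comp_d := fun p q => LinearMap.ext fun f => Subtype.ext ((hhom q).app_app ⊤ f.1)
      δ_comp_δ := fun p q => LinearMap.ext fun f => Subtype.ext (N.coboundary_coboundary q f.1)
      comm := fun p q => LinearMap.ext fun f => Subtype.ext (hcomm q f.1).symm }
  refine ⟨Ψ, ⟨h1, hface⟩, ?_, hhom, hcomm, hdouble, hdouble.isTotalDifferential⟩
  rintro Ψ' ⟨h1', hface'⟩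
  funext q
  rcases q with _ | q
  · have := hface' 0 0
    rw [show Ψ' (0 + 1) = 𝒢.ψ from h1'] at this
    exact ZGraded.VectorField.eq_of_section 𝒢.one_src this hs
  · refine ZGraded.VectorField.eq_of_jointlyMonic (N.isTuples_level q).jointlyMonic ?_ (hΦ q)
    exact fun j => h1' ▸ N.related_entry_of_related_face hface' q j
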